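/- **Setting.** Let $p,p^*>1$ with $1/p+1/p^*=1$. Let $X$ be a real Banach space that is $p$-convex (its modulus of convexity satisfies $\delta_X(\tau)\ge K\tau^p$ on $(0,2]$ for some $K>0$) and uniformly smooth, and let $Y_1,\dots,Y_N$ be uniformly smooth real Banach spaces. For a Banach space $E$ let $J_p^E(x)=\{\xi\in E^*:\langle \xi,x\rangle=\|x\|\|\xi\|,\ \|\xi\|=\|x\|^{p-1}\}$ denote the duality map with gauge $t\mapsto t^{p-1}$ (single-valued on the spaces at hand), and let $$D(z,w)=\tfrac1{p^*}\|z\|^p+\tfrac1p\|w\|^p-\langle J_p^X(z),w\rangle$$ be the Bregman distance on $X$. Let $G>0$ be a constant such that the corresponding Bregman distance $D_{X^*}(\xi,\eta)=\frac1p\|\xi\|^{p^*}+\frac1{p^*}\|\eta\|^{p^*}-\langle J_{p^*}^{X^*}(\xi),\eta\rangle$ on $X^*$ satisfies $D_{X^*}(\xi,\eta)\le \frac{G}{p^*}\|\eta-\xi\|^{p^*}$ for all $\xi,\eta\in X^*$. Let $S\subset X$ be closed and convex, let $F_i$ ($i=1,\dots,N$) be maps from a domain containing $S$ into $Y_i$,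 let $y=(y_1,\dots,y_N)\in Y_1\times\dots\times Y_N$, and let $x_0\in X$. Let $x^\dagger\in S$ be an $x_0$-minimum-distance solution, i.e. $F_i(x^\dagger)=y_i$ for all $i$, and $D(x_0,x^\dagger)\le D(x_0,x)$ for every $x\in S$ with $F_i(x)=y_i$ for all $i$. Let $0<\gamma<1/2$, $\omega>0$, $\Gamma\in\mathbb R$, and $$\nu=D(x_0,x^\dagger)+\tfrac{\omega^{-p}}{p}(1+\gamma)^p\,\Gamma .$$ Assume: 1. $\{z\in X: D(z,x^\dagger)\le\nu\}\subset S$; 2. each $F_i$ is continuously Fréchet differentiable on $S$, with $\|F_i'(x)\|\le L_i$ for all $x\in S$; put $L_{\max}=\max_i L_i$; 3. $\|F_i(x)-F_i(\tilde x)-F_i'(x)(x-\tilde x)\|\le\gamma\|F_i(x)-F_i(\tilde x)\|$ for all $i$ and all $x,\tilde x\in S$; 4. each $F_i$ is weak-to-weak (sequentially) continuous on $S$; 5. $\bigcap_i\ker F_i'(x^\dagger)\subset\bigcap_i\ker F_i'(x)$ for all $x\in S$. **Noisy data and iteration.** For every $\delta>0$ let $y^\delta$ satisfy $\|y_i-y_i^\delta\|\le\delta$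 for all $i$. Let $i_1,i_2,\dots$ be independent random indices, uniformly distributed on $\{1,\dots,N\}$, let $\mu_1,\mu_2,\ldots>0$, and let $x_0^\delta=x_0$, $$x_{k+1}^\delta=J_{p^*}^{X^*}\Big(J_p^X(x_k^\delta)-\mu_{k+1}\,F_{i_{k+1}}'(x_k^\delta)^*J_p^{Y_{i_{k+1}}}\big(F_{i_{k+1}}(x_k^\delta)-y_{i_{k+1}}^\delta\big)\Big),\qquad k\ge0,$$ where $X^{**}$ is identified with $X$ (the $F_i$ may be extended arbitrarily outside $S$; this does not affect the limit below). **Theorem.** Suppose that $\sum_{k\ge1}\mu_k=\infty$ and that for some $C>0$ $$1-\gamma-L_{\max}^{p^*}\tfrac{G}{p^*}\mu_\ell^{p^*-1}-\tfrac{p-1}{p^2}\omega^{p^*}\ge C\qquad\text{for all }\ell\ge1 .$$ Let the stopping indices $k(\delta)\in\mathbb N$ satisfy $\delta^p\sum_{\ell=1}^{k(\delta)}\mu_\ell\le\Gamma$ for all sufficiently small $\delta>0$, $\lim_{\delta\searrow0}k(\delta)=\infty$, and $\lim_{\delta\searrow0}\delta^p\sum_{\ell=1}^{k(\delta)}\mu_\ell=0$.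 Then $D(x_{k(\delta)}^\delta,x^\dagger)$ is integrable for every $\delta>0$, and $$\lim_{\delta\searrow0}\mathbb E\big[D(x_{k(\delta)}^\delta,x^\dagger)\big]=0 .$$ -/

import Mathlib

open Filter Topology MeasureTheory ProbabilityTheory

namespace SGDBanach

noncomputable section

/-! ### Geometry of Banach spaces -/

/-- Modulus of convexity: the infimum of `1 - ‖z + w‖ / 2` over unit vectors `z`, `w` with
`‖z - w‖ ≥ τ`, as an extended real (so that the infimum over the empty set is `+∞`). -/
def convexityModulus (E : Type*) [NormedAddCommGroup E] (τ : ℝ) : EReal :=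
  ⨅ (z : E) (w : E) (_ : ‖z‖ = 1) (_ : ‖w‖ = 1) (_ : τ ≤ ‖z - w‖),
    ((1 - ‖z + w‖ / 2 : ℝ) : EReal)

/-- `E` is `p`-convex: the modulus of convexity is at least `K τ ^ p` on `(0, 2]`,
for some `K > 0`. -/
def IsPConvex (p : ℝ) (E : Type*) [NormedAddCommGroup E] : Prop :=
  1 < p ∧ ∃ K : ℝ, 0 < K ∧
    ∀ τ : ℝ, 0 < τ → τ ≤ 2 → ((K * τ ^ p : ℝ) : EReal) ≤ convexityModulus E τ

/-- Modulus of smoothness. The set is bounded above by `τ` for `τ ≥ 0`. -/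
def smoothnessModulus (E : Type*) [NormedAddCommGroup E] [NormedSpace ℝ E] (τ : ℝ) : ℝ :=
  sSup {d : ℝ | ∃ z w : E, ‖z‖ = 1 ∧ ‖w‖ = 1 ∧ d = (‖z + τ • w‖ + ‖z - τ • w‖) / 2 - 1}

/-- `E` is uniformly smooth. -/
def IsUniformlySmooth (E : Type*) [NormedAddCommGroup E] [NormedSpace ℝ E] : Prop :=
  Tendsto (fun τ : ℝ => smoothnessModulus E τ / τ) (𝓝[>] 0) (𝓝 0)

/-! ### Duality maps and Bregman distances -/

section Duality

variable {E : Type*} [NormedAddCommGroup E] [NormedSpace ℝ E]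

/-- The set-valued duality map with gauge function `t ↦ t ^ (p - 1)`. -/
def dualityMap (p : ℝ) (x : E) : Set (StrongDual ℝ E) :=
  {f | f x = ‖x‖ * ‖f‖ ∧ ‖x‖ ^ (p - 1) = ‖f‖}

/-- A single-valued selection of the duality map (the duality map itself if `E` is smooth). -/
def dualitySel (p : ℝ) (x : E) : StrongDual ℝ E :=
  Classical.epsilon fun f => f ∈ dualityMap p x

/-- The duality map with gauge `t ↦ t ^ (r - 1)` of the dual space, with values in `E` through
the canonical embedding of `E` in its bidual (which is onto for reflexive `E`). -/
def dualitySelDual (r : ℝ) (ξ : StrongDual ℝ E) : E :=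
  Classical.epsilon fun x : E =>
    NormedSpace.inclusionInDoubleDual ℝ E x ∈ dualityMap r ξ

/-- The Bregman distance
`D(z, w) = ‖z‖ ^ p / p* + ‖w‖ ^ p / p - ⟨J_p z, w⟩`, where `1 / p + 1 / p* = 1`. -/
def bregman (p : ℝ) (z w : E) : ℝ :=
  1 / p.conjExponent * ‖z‖ ^ p + 1 / p * ‖w‖ ^ p - dualitySel p z w

/-- The closed Bregman ball of radius `ν` around `x`. -/
def bregmanBall (p ν : ℝ) (x : E) : Set E := {z | bregman p z x ≤ ν}

end Duality

/-- Weak-to-weak (sequential) continuity on the set `S`. -/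
def WeakToWeakContinuousOn {E G : Type*} [NormedAddCommGroup E] [NormedSpace ℝ E]
    [NormedAddCommGroup G] [NormedSpace ℝ G] (f : E → G) (S : Set E) : Prop :=
  ∀ (u : ℕ → E) (x : E), (∀ n, u n ∈ S) → x ∈ S →
    (∀ φ : StrongDual ℝ E, Tendsto (fun n => φ (u n)) atTop (𝓝 (φ x))) →
    ∀ ψ : StrongDual ℝ G, Tendsto (fun n => ψ (f (u n))) atTop (𝓝 (ψ (f x)))

/-! ### The system of equations and stochastic gradient descent -/

section SGD

variable {X : Type*} [NormedAddCommGroup X] [NormedSpace ℝ X]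
  {N : ℕ} {Y : Fin N → Type*} [∀ i, NormedAddCommGroup (Y i)] [∀ i, NormedSpace ℝ (Y i)]

/-- `xs` is an `x₀`-minimum-distance solution in `S` of the system `F i x = y i`. -/
def IsMinDistSolution (p : ℝ) (S : Set X) (F : ∀ i, X → Y i) (y : ∀ i, Y i)
    (x₀ xs : X) : Prop :=
  xs ∈ S ∧ (∀ i, F i xs = y i) ∧
    ∀ x ∈ S, (∀ i, F i x = y i) → bregman p x₀ xs ≤ bregman p x₀ x

/-- The stochastic gradient `F_i'(x)^* J_p(F_i(x) - y_i)`; the adjoint of a bounded linear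
operator `A` is `ξ ↦ ξ ∘ A`. -/
def sgdGradient (p : ℝ) (F : ∀ i, X → Y i) (F' : ∀ i, X → X →L[ℝ] Y i) (y : ∀ i, Y i)
    (x : X) (i : Fin N) : StrongDual ℝ X :=
  (dualitySel p (F i x - y i)).comp (F' i x)

/-- The iterates
`x_{k+1} = J_{p*}^{X*} (J_p(x_k) - μ_{k+1} F_i'(x_k)^* J_p(F_i(x_k) - y_i))`, `i = i_{k+1}`,
of stochastic gradient descent for data `y`, along the index sequence `i`. -/
def sgdIterate (p : ℝ) (F : ∀ i, X → Y i) (F' : ∀ i, X → X →L[ℝ] Y i) (y : ∀ i, Y i)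
    (μ : ℕ → ℝ) (x₀ : X) (i : ℕ → Fin N) : ℕ → X
  | 0 => x₀
  | k + 1 =>
      dualitySelDual p.conjExponent
        (dualitySel p (sgdIterate p F F' y μ x₀ i k) -
          μ (k + 1) • sgdGradient p F F' y (sgdIterate p F F' y μ x₀ i k) (i (k + 1)))

end SGD

end

end SGDBanach

/-!
Each step decreases the Bregman distance to `x†` by a multiple of `μ ‖F_i x - y_i‖ ^ p`, up to an
error of order `δ ^ p μ`. For exact data the expected distances `d_n` are therefore nonincreasing,
and since the indices are uniform and independent, the expected residuals `e_n` satisfy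
`∑ μ_{n+1} e_n < ∞`. As `∑ μ_n = ∞`, there are indices `k` beyond any given `l` at which `e_k` is
arbitrarily small and minimal among `e_l, ..., e_k`. There one estimates
`D(x_k, x†) ≤ ⟨J x_k - J x†, x_k - x†⟩` by splitting `J x_k - J x†` at `J x_l`. The functional
`J x_l - J x†` annihilates the null space of `F'(x†)`, by the minimality of `x†` and the null-space
condition; as `X` is reflexive, it is a limit of elements of the range of `F'(x†)^*`, and so it is
controlled by the residual of `x_k`. By the tangential cone condition, `J x_k - J x_l` contributes
at most a multiple of `∑ μ_{m+1} e_m`, `l ≤ m < k`, that is, of `d_l - d_k`. Letting `l → ∞` gives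
`d_n → 0`. For noisy data, the first `n` iterates depend continuously on the data, and beyond `n`
the expected distance increases at most by a multiple of `δ ^ p ∑ μ_l`.
-/

namespace SGDBanach

section RealInequalities

variable {p p' a t κ : ℝ}

theorem mul_rpow_sub_one_self (ha : 0 ≤ a) (hp : p ≠ 0) : a * a ^ (p - 1) = a ^ p := by
  rw [← Real.rpow_one_add' ha (by rwa [add_sub_cancel]), add_sub_cancel]

theorem rpow_sub_one_rpow (hpp' : p.HolderConjugate p') (ha : 0 ≤ a) :
    (a ^ (p - 1)) ^ p' = a ^ p := by
  rw [← Real.rpow_mul ha, hpp'.sub_one_mul_conj]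

theorem rpow_sub_one_rpow_sub_one (hpp' : p.HolderConjugate p') (ha : 0 ≤ a) :
    (a ^ (p - 1)) ^ (p' - 1) = a := by
  rw [← Real.rpow_mul ha, mul_sub_one, hpp'.sub_one_mul_conj, sub_sub_cancel, Real.rpow_one]

theorem rpow_sub_one_mul_le (hp : 1 < p) (ha : 0 ≤ a) (ht : 0 ≤ t) (hκ : 0 < κ) :
    a ^ (p - 1) * t ≤ κ * a ^ p + t ^ p / κ ^ (p - 1) := by
  have hp₀ : p ≠ 0 := by linarith
  rcases le_total t (κ * a) with h | h
  · calc a ^ (p - 1) * t ≤ a ^ (p - 1) * (κ * a) := by gcongr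
      _ = κ * a ^ p := by rw [← mul_rpow_sub_one_self ha hp₀]; ring
      _ ≤ κ * a ^ p + t ^ p / κ ^ (p - 1) := le_add_of_nonneg_right (by positivity)
  · have haκ : a ≤ t / κ := (le_div_iff₀' hκ).2 h
    calc a ^ (p - 1) * t ≤ (t / κ) ^ (p - 1) * t := by
          gcongr
      _ = t ^ p / κ ^ (p - 1) := by
          rw [Real.div_rpow ht hκ.le, ← mul_rpow_sub_one_self ht hp₀]; ring
      _ ≤ κ * a ^ p + t ^ p / κ ^ (p - 1) := le_add_of_nonneg_left (by positivity)

theorem le_add_rpow_div (hp : 1 < p) (ha : 0 ≤ a) (ht : 0 < t) :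
    a ≤ t + a ^ p / t ^ (p - 1) := by
  have hpow : 0 < t ^ (p - 1) := by positivity
  have hyoung := rpow_sub_one_mul_le hp ht.le ha one_pos
  have htp := mul_rpow_sub_one_self ht.le (show p ≠ 0 by linarith)
  rw [Real.one_rpow, div_one, one_mul] at hyoung
  rw [← sub_le_iff_le_add', le_div_iff₀ hpow]
  linarith

end RealInequalities

section DualityMaps

variable {E : Type*} [NormedAddCommGroup E] [NormedSpace ℝ E] {p p' : ℝ}

theorem dualityMap_nonempty (hp : 1 < p) (x : E) : (dualityMap p x).Nonempty := by
  rcases eq_or_ne x 0 with rfl | hx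
  · exact ⟨0, by simp [dualityMap, Real.zero_rpow (sub_pos.2 hp).ne']⟩
  · obtain ⟨g, hg, hgx⟩ := exists_dual_vector ℝ x (norm_ne_zero_iff.2 hx)
    have hpow : ‖‖x‖ ^ (p - 1) • g‖ = ‖x‖ ^ (p - 1) := by
      rw [norm_smul, hg, mul_one, Real.norm_of_nonneg (by positivity)]
    refine ⟨‖x‖ ^ (p - 1) • g, ?_, hpow.symm⟩
    rw [hpow, smul_apply, hgx, smul_eq_mul, mul_comm]
    rfl

theorem dualitySel_mem (hp : 1 < p) (x : E) : dualitySel p x ∈ dualityMap p x :=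
  Classical.epsilon_spec (dualityMap_nonempty hp x)

theorem norm_dualitySel (hp : 1 < p) (x : E) : ‖dualitySel p x‖ = ‖x‖ ^ (p - 1) :=
  (dualitySel_mem hp x).2.symm

theorem apply_self_of_mem_dualityMap (hp : p ≠ 0) {x : E} {f : StrongDual ℝ E}
    (hf : f ∈ dualityMap p x) : f x = ‖x‖ ^ p := by
  rw [hf.1, ← hf.2, mul_rpow_sub_one_self (norm_nonneg x) hp]

theorem dualitySel_apply_self (hp : 1 < p) (x : E) : dualitySel p x x = ‖x‖ ^ p :=
  apply_self_of_mem_dualityMap (by linarith) (dualitySel_mem hp x)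

theorem dualitySel_apply_le (hp : 1 < p) (x w : E) :
    dualitySel p x w ≤ ‖x‖ ^ (p - 1) * ‖w‖ := by
  rw [← norm_dualitySel hp]
  exact (le_abs_self _).trans ((dualitySel p x).le_opNorm w)

theorem dualitySel_zero (hp : 1 < p) : dualitySel p (0 : E) = 0 := by
  rw [← norm_eq_zero, norm_dualitySel hp, norm_zero, Real.zero_rpow (sub_pos.2 hp).ne']

theorem bregman_eq (hpp' : p.HolderConjugate p') (z w : E) :
    bregman p z w = ‖z‖ ^ p / p' + ‖w‖ ^ p / p - dualitySel p z w := by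
  rw [bregman, hpp'.conjExponent_eq, one_div_mul_eq_div, one_div_mul_eq_div]

theorem bregman_eq_sub (hpp' : p.HolderConjugate p') (z w : E) :
    bregman p z w = ‖w‖ ^ p / p - ‖z‖ ^ p / p - dualitySel p z (w - z) := by
  rw [bregman_eq hpp', map_sub, dualitySel_apply_self hpp'.lt, div_eq_mul_inv _ p',
    ← hpp'.one_sub_inv]
  ring

theorem bregman_nonneg (hpp' : p.HolderConjugate p') (z w : E) : 0 ≤ bregman p z w := by
  have hyoung := Real.young_inequality_of_nonneg (by positivity : 0 ≤ ‖z‖ ^ (p - 1))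
    (norm_nonneg w) hpp'.symm
  rw [rpow_sub_one_rpow hpp' (norm_nonneg z)] at hyoung
  rw [bregman_eq hpp']
  linarith [dualitySel_apply_le hpp'.lt z w]

theorem bregman_self (hpp' : p.HolderConjugate p') (z : E) : bregman p z z = 0 := by
  simp [bregman_eq_sub hpp']

theorem bregman_add_bregman (hpp' : p.HolderConjugate p') (z w : E) :
    bregman p z w + bregman p w z = (dualitySel p z - dualitySel p w) (z - w) := by
  simp only [bregman_eq_sub hpp', sub_apply, map_sub]
  ring

theorem bregman_le_sub_apply_sub (hpp' : p.HolderConjugate p') (z w : E) :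
    bregman p z w ≤ (dualitySel p z - dualitySel p w) (z - w) := by
  rw [← bregman_add_bregman hpp']
  exact le_add_of_nonneg_right (bregman_nonneg hpp' w z)

theorem exists_norm_le_of_bregman_le (hpp' : p.HolderConjugate p') (w : E) (r : ℝ) :
    ∃ B : ℝ, ∀ z : E, bregman p z w ≤ r → ‖z‖ ≤ B := by
  have hp := hpp'.pos
  have hp' := hpp'.symm.pos
  refine ⟨max (2 * p' * ‖w‖) ((2 * p' * |r|) ^ p⁻¹), fun z hz => ?_⟩
  by_contra! hlt
  obtain ⟨hzw, hzr⟩ := max_lt_iff.1 hlt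
  rw [Real.rpow_inv_lt_iff_of_pos (by positivity) (norm_nonneg z) hp] at hzr
  have hcross : ‖z‖ ^ (p - 1) * (2 * p' * ‖w‖) ≤ ‖z‖ ^ p := by
    rw [← mul_rpow_sub_one_self (norm_nonneg z) hp.ne', mul_comm ‖z‖]
    gcongr
  have hbreg : ‖z‖ ^ p / p' - ‖z‖ ^ (p - 1) * ‖w‖ ≤ |r| := by
    rw [bregman_eq hpp'] at hz
    have : 0 ≤ ‖w‖ ^ p / p := by positivity
    linarith [dualitySel_apply_le hpp'.lt z w, le_abs_self r]
  have hscaled := mul_le_mul_of_nonneg_right hbreg (by positivity : 0 ≤ 2 * p')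
  have hdiv : ‖z‖ ^ p / p' * (2 * p') = 2 * ‖z‖ ^ p := by field_simp
  linarith

end DualityMaps

section UniformlySmooth

variable {E : Type*} [NormedAddCommGroup E] [NormedSpace ℝ E] {p p' : ℝ}

theorem norm_inv_norm_smul {x : E} (hx : x ≠ 0) : ‖‖x‖⁻¹ • x‖ = 1 := by
  rw [norm_smul, norm_inv, norm_norm, inv_mul_cancel₀ (norm_ne_zero_iff.2 hx)]

theorem norm_add_norm_le_smoothnessModulus {τ : ℝ} (hτ : 0 ≤ τ) {z w : E} (hz : ‖z‖ = 1)
    (hw : ‖w‖ = 1) : ‖z + τ • w‖ + ‖z - τ • w‖ ≤ 2 + 2 * smoothnessModulus E τ := by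
  have hle : (‖z + τ • w‖ + ‖z - τ • w‖) / 2 - 1 ≤ smoothnessModulus E τ := by
    refine le_csSup ⟨τ, ?_⟩ ⟨z, w, hz, hw, rfl⟩
    rintro d ⟨z, w, hz, hw, rfl⟩
    have hadd := norm_add_le z (τ • w)
    have hsub := norm_sub_le z (τ • w)
    rw [norm_smul, Real.norm_of_nonneg hτ, hz, hw] at hadd hsub
    linarith
  linarith

theorem norm_le_of_forall_unit_apply_le {f : StrongDual ℝ E} {r : ℝ} (hr : 0 ≤ r)
    (h : ∀ w : E, ‖w‖ = 1 → f w ≤ r) : ‖f‖ ≤ r := by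
  refine f.opNorm_le_of_unit_norm hr fun w hw => abs_le.2 ⟨?_, h w hw⟩
  have := h (-w) (by rwa [norm_neg])
  rw [map_neg] at this
  linarith

theorem exists_unit_lt_apply {f : StrongDual ℝ E} {r : ℝ} (hr : 0 ≤ r) (hrf : r < ‖f‖) :
    ∃ x : E, ‖x‖ = 1 ∧ r < f x := by
  by_contra! h
  exact hrf.not_ge (norm_le_of_forall_unit_apply_le hr h)

theorem IsUniformlySmooth.exists_norm_sub_le (hE : IsUniformlySmooth E) {ε : ℝ} (hε : 0 < ε) :
    ∃ η > 0, ∀ (x : E) (f g : StrongDual ℝ E), x ≠ 0 → ‖f‖ ≤ 1 → ‖g‖ ≤ 1 →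
      (2 - η) * ‖x‖ ≤ f x + g x → ‖f - g‖ ≤ ε := by
  have hsmall := (hE.eventually (gt_mem_nhds (show (0 : ℝ) < ε / 4 by positivity))).and
    self_mem_nhdsWithin
  obtain ⟨τ, hτε, hτ : 0 < τ⟩ := hsmall.exists
  rw [div_lt_iff₀ hτ] at hτε
  refine ⟨τ * ε / 2, by positivity, fun x f g hx hf hg hfg => ?_⟩
  refine norm_le_of_forall_unit_apply_le hε.le fun w hw => ?_
  have apply_le_norm {h : StrongDual ℝ E} (hh : ‖h‖ ≤ 1) (v : E) : h v ≤ ‖v‖ :=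
    (le_abs_self _).trans ((h.le_of_opNorm_le hh v).trans_eq (one_mul _))
  have hfw := apply_le_norm hf (‖x‖⁻¹ • x + τ • w)
  have hgw := apply_le_norm hg (‖x‖⁻¹ • x - τ • w)
  have hmod := norm_add_norm_le_smoothnessModulus hτ.le (norm_inv_norm_smul hx) hw
  rw [← le_inv_mul_iff₀' (norm_pos_iff.2 hx)] at hfg
  simp only [map_add, map_sub, map_smul, smul_eq_mul] at hfw hgw
  rw [sub_apply]
  refine le_of_mul_le_mul_left ?_ hτ
  linarith

theorem IsUniformlySmooth.eq_of_apply_eq_norm (hE : IsUniformlySmooth E) {x : E} (hx : x ≠ 0)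
    {f g : StrongDual ℝ E} (hf : ‖f‖ = 1) (hg : ‖g‖ = 1) (hfx : f x = ‖x‖) (hgx : g x = ‖x‖) :
    f = g := by
  rw [← sub_eq_zero, ← norm_le_zero_iff]
  refine le_of_forall_pos_le_add fun ε hε => ?_
  obtain ⟨η, hη, h⟩ := hE.exists_norm_sub_le hε
  rw [zero_add]
  refine h x f g hx hf.le hg.le ?_
  linarith [mul_nonneg hη.le (norm_nonneg x)]

theorem norm_inv_rpow_smul_of_mem_dualityMap {x : E} {f : StrongDual ℝ E} (hx : x ≠ 0)
    (hf : f ∈ dualityMap p x) : ‖(‖x‖ ^ (p - 1))⁻¹ • f‖ = 1 := by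
  rw [norm_smul, ← hf.2, norm_inv, Real.norm_of_nonneg (by positivity),
    inv_mul_cancel₀ (by positivity)]

theorem inv_rpow_smul_apply_of_mem_dualityMap {x : E} {f : StrongDual ℝ E} (hx : x ≠ 0)
    (hf : f ∈ dualityMap p x) : ((‖x‖ ^ (p - 1))⁻¹ • f) x = ‖x‖ := by
  rw [smul_apply, hf.1, ← hf.2, smul_eq_mul, mul_comm ‖x‖, inv_mul_cancel_left₀ (by positivity)]

theorem IsUniformlySmooth.dualitySel_eq (hE : IsUniformlySmooth E) (hp : 1 < p) {x : E}
    {f : StrongDual ℝ E} (hf : f ∈ dualityMap p x) : dualitySel p x = f := by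
  rcases eq_or_ne x 0 with rfl | hx
  · rw [dualitySel_zero hp, eq_comm, ← norm_eq_zero, ← hf.2, norm_zero,
      Real.zero_rpow (sub_pos.2 hp).ne']
  · have hJ := dualitySel_mem hp x
    refine smul_right_injective _ (inv_ne_zero (by positivity : ‖x‖ ^ (p - 1) ≠ 0)) ?_
    exact hE.eq_of_apply_eq_norm hx (norm_inv_rpow_smul_of_mem_dualityMap hx hJ)
      (norm_inv_rpow_smul_of_mem_dualityMap hx hf) (inv_rpow_smul_apply_of_mem_dualityMap hx hJ)
      (inv_rpow_smul_apply_of_mem_dualityMap hx hf)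

theorem IsUniformlySmooth.continuousAt_inv_rpow_smul_dualitySel (hE : IsUniformlySmooth E)
    (hp : 1 < p) {x : E} (hx : x ≠ 0) :
    ContinuousAt (fun u : E => (‖u‖ ^ (p - 1))⁻¹ • dualitySel p u) x := by
  set f : E → StrongDual ℝ E := fun u => (‖u‖ ^ (p - 1))⁻¹ • dualitySel p u
  have norm_f {u : E} (hu : u ≠ 0) : ‖f u‖ = 1 :=
    norm_inv_rpow_smul_of_mem_dualityMap hu (dualitySel_mem hp u)
  have f_apply {u : E} (hu : u ≠ 0) : f u u = ‖u‖ :=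
    inv_rpow_smul_apply_of_mem_dualityMap hu (dualitySel_mem hp u)
  rw [ContinuousAt, Metric.tendsto_nhds]
  intro ε hε
  obtain ⟨η, hη, hclose⟩ := hE.exists_norm_sub_le (half_pos hε)
  have hnear : ∀ᶠ u in 𝓝 x, 2 * ‖x - u‖ < η * ‖x‖ := by
    have hcont : Continuous fun u => 2 * ‖x - u‖ := by fun_prop
    refine (hcont.tendsto x).eventually (gt_mem_nhds ?_)
    rw [sub_self, norm_zero, mul_zero]
    positivity
  filter_upwards [eventually_ne_nhds hx, hnear] with u hu hux
  rw [dist_eq_norm]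
  refine (hclose x _ _ hx (norm_f hu).le (norm_f hx).le ?_).trans_lt (half_lt_self hε)
  have hdiff := neg_le_of_abs_le ((f u).le_of_opNorm_le (norm_f hu).le (x - u))
  rw [map_sub, f_apply hu, one_mul] at hdiff
  rw [f_apply hx]
  linarith [norm_sub_norm_le x u]

theorem IsUniformlySmooth.continuous_dualitySel (hE : IsUniformlySmooth E) (hp : 1 < p) :
    Continuous (dualitySel p : E → StrongDual ℝ E) := by
  have hp' : 0 < p - 1 := sub_pos.2 hp
  have hpow : Continuous fun u : E => ‖u‖ ^ (p - 1) :=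
    continuous_norm.rpow_const fun _ => Or.inr hp'.le
  refine continuous_iff_continuousAt.2 fun x => ?_
  rcases eq_or_ne x 0 with rfl | hx
  · rw [ContinuousAt, dualitySel_zero hp, tendsto_zero_iff_norm_tendsto_zero]
    simp only [norm_dualitySel hp]
    simpa only [norm_zero, Real.zero_rpow hp'.ne'] using hpow.tendsto 0
  · refine (hpow.continuousAt.smul
      (hE.continuousAt_inv_rpow_smul_dualitySel hp hx)).congr ?_
    filter_upwards [eventually_ne_nhds hx] with u hu
    exact smul_inv_smul₀ (by positivity : ‖u‖ ^ (p - 1) ≠ 0) _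

theorem IsUniformlySmooth.continuous_bregman_left (hE : IsUniformlySmooth E)
    (hpp' : p.HolderConjugate p') (w : E) : Continuous fun z : E => bregman p z w := by
  simp only [bregman_eq hpp']
  have hpow : Continuous fun z : E => ‖z‖ ^ p :=
    continuous_norm.rpow_const fun _ => Or.inr hpp'.pos.le
  have hdual : Continuous fun z : E => dualitySel p z w :=
    (hE.continuous_dualitySel hpp'.lt).clm_apply continuous_const
  fun_prop

theorem IsUniformlySmooth.dualitySel_apply_le_of_eventually_bregman_le
    (hE : IsUniformlySmooth E) (hpp' : p.HolderConjugate p') {x₀ w v : E}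
    (hmin : ∀ᶠ t : ℝ in 𝓝[>] 0, bregman p x₀ w ≤ bregman p x₀ (w + t • v)) :
    dualitySel p x₀ v ≤ dualitySel p w v := by
  have hline : Continuous fun t : ℝ => w + t • v := by fun_prop
  have hlim : Tendsto (fun t : ℝ => dualitySel p (w + t • v) v) (𝓝[>] 0)
      (𝓝 (dualitySel p w v)) := by
    have hcont := ((hE.continuous_dualitySel hpp'.lt).comp hline).clm_apply
      (continuous_const (y := v))
    simpa using (hcont.tendsto 0).mono_left nhdsWithin_le_nhds
  refine ge_of_tendsto hlim ?_
  filter_upwards [hmin, self_mem_nhdsWithin] with t hle (ht : 0 < t)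
  have hconvex := bregman_nonneg hpp' (w + t • v) w
  simp only [bregman_eq_sub hpp', sub_add_cancel_left, map_neg, map_smul, map_sub, map_add,
    smul_eq_mul] at hle hconvex
  exact le_of_mul_le_mul_left (by linarith) ht

end UniformlySmooth

section PowerSmooth

/-- Smoothness of power type: the Bregman distance of the gauge `t ↦ t ^ (p - 1)` is bounded by
`c` times the `p`-th power of the norm distance. -/
def IsPowerSmooth (p c : ℝ) (E : Type*) [NormedAddCommGroup E] [NormedSpace ℝ E] : Prop :=
  ∀ z w : E, bregman p z w ≤ c * ‖w - z‖ ^ p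

variable {E : Type*} [NormedAddCommGroup E] [NormedSpace ℝ E] {p p' c : ℝ}

theorem smoothnessModulus_nonneg (τ : ℝ) : 0 ≤ smoothnessModulus E τ := by
  refine Real.sSup_nonneg ?_
  rintro d ⟨z, w, hz, -, rfl⟩
  have htwo := norm_add_le (z + τ • w) (z - τ • w)
  rw [add_add_sub_cancel, ← two_smul ℝ z, norm_smul, hz, Real.norm_two] at htwo
  linarith

theorem IsPowerSmooth.smoothnessModulus_le (h : IsPowerSmooth p c E)
    (hpp' : p.HolderConjugate p') (hc : 0 ≤ c) {τ : ℝ} (hτ : 0 ≤ τ) :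
    smoothnessModulus E τ ≤ c * τ ^ p := by
  refine Real.sSup_le ?_ (by positivity)
  rintro d ⟨z, w, hz, hw, rfl⟩
  have norm_le_of_bregman_le (v : E) (hv : bregman p z (z + v) ≤ c * τ ^ p) :
      ‖z + v‖ ≤ 1 + dualitySel p z v + c * τ ^ p := by
    have hbernoulli := one_add_mul_self_le_rpow_one_add
      (by linarith [norm_nonneg (z + v)] : -1 ≤ ‖z + v‖ - 1) hpp'.lt.le
    rw [add_sub_cancel, add_comm, ← le_sub_iff_add_le, ← le_div_iff₀' hpp'.pos, sub_div]
      at hbernoulli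
    rw [bregman_eq_sub hpp', hz, Real.one_rpow, add_sub_cancel_left] at hv
    linarith
  have hnorm : ‖τ • w‖ = τ := by rw [norm_smul, hw, mul_one, Real.norm_of_nonneg hτ]
  have hadd := norm_le_of_bregman_le (τ • w) (by
    simpa only [add_sub_cancel_left, hnorm] using h z (z + τ • w))
  have hsub := norm_le_of_bregman_le (-(τ • w)) (by
    simpa only [add_sub_cancel_left, norm_neg, hnorm] using h z (z + -(τ • w)))
  rw [map_neg, ← sub_eq_add_neg] at hsub
  linarith

theorem IsPowerSmooth.isUniformlySmooth (h : IsPowerSmooth p c E)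
    (hpp' : p.HolderConjugate p') (hc : 0 ≤ c) : IsUniformlySmooth E := by
  have hlim : Tendsto (fun τ : ℝ => c * τ ^ (p - 1)) (𝓝[>] 0) (𝓝 0) := by
    have hcont : Continuous fun τ : ℝ => c * τ ^ (p - 1) :=
      continuous_const.mul (Real.continuous_rpow_const hpp'.sub_one_pos.le)
    simpa [Real.zero_rpow hpp'.sub_one_pos.ne'] using
      (hcont.tendsto 0).mono_left nhdsWithin_le_nhds
  refine squeeze_zero' ?_ ?_ hlim <;> filter_upwards [self_mem_nhdsWithin] with τ (hτ : 0 < τ)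
  · exact div_nonneg (smoothnessModulus_nonneg τ) hτ.le
  · rw [div_le_iff₀' hτ, mul_left_comm, mul_rpow_sub_one_self hτ.le hpp'.pos.ne']
    exact h.smoothnessModulus_le hpp' hc hτ.le

end PowerSmooth

section Reflexive

open NormedSpace (inclusionInDoubleDual inclusionInDoubleDualLi dual_def)

variable {X : Type*} [NormedAddCommGroup X] [NormedSpace ℝ X] {p p' c : ℝ}

theorem norm_inclusionInDoubleDual (x : X) : ‖inclusionInDoubleDual ℝ X x‖ = ‖x‖ :=
  (inclusionInDoubleDualLi (E := X) ℝ).norm_map x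

theorem inclusionInDoubleDual_mem_dualityMap_iff (hpp' : p.HolderConjugate p') {x : X}
    {ξ : StrongDual ℝ X} : inclusionInDoubleDual ℝ X x ∈ dualityMap p' ξ ↔ ξ ∈ dualityMap p x := by
  simp only [dualityMap, Set.mem_ofPred_eq, dual_def, norm_inclusionInDoubleDual, mul_comm ‖ξ‖]
  refine and_congr_right fun _ => ⟨fun h => ?_, fun h => ?_⟩
  · rw [← h, rpow_sub_one_rpow_sub_one hpp'.symm (norm_nonneg ξ)]
  · rw [← h, rpow_sub_one_rpow_sub_one hpp' (norm_nonneg x)]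

theorem surjective_inclusionInDoubleDual_of_isUniformlySmooth_dual [CompleteSpace X]
    (hX : IsUniformlySmooth (StrongDual ℝ X)) :
    Function.Surjective (inclusionInDoubleDual ℝ X) := by
  have hclosed : IsClosed (Set.range (inclusionInDoubleDual ℝ X)) := by
    have hisom : Isometry (inclusionInDoubleDual ℝ X) := (inclusionInDoubleDualLi ℝ).isometry
    exact hisom.isClosedEmbedding.isClosed_range
  have hunit (Φ : StrongDual ℝ (StrongDual ℝ X)) (hΦ : ‖Φ‖ = 1) :
      Φ ∈ Set.range (inclusionInDoubleDual ℝ X) := by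
    rw [← hclosed.closure_eq]
    refine (Metric.mem_closure_range_iff (e := inclusionInDoubleDual ℝ X)).2 fun ε hε => ?_
    obtain ⟨η, hη, hclose⟩ := hX.exists_norm_sub_le (half_pos hε)
    have hr : max 0 (1 - η / 2) < 1 := max_lt one_pos (by linarith)
    obtain ⟨ξ, hξ, hΦξ⟩ := exists_unit_lt_apply (le_max_left _ _) (hr.trans_eq hΦ.symm)
    obtain ⟨x, hx, hξx⟩ := exists_unit_lt_apply (le_max_left _ _) (hr.trans_eq hξ.symm)
    refine ⟨x, (dist_eq_norm Φ _).trans_lt (lt_of_le_of_lt ?_ (half_lt_self hε))⟩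
    refine hclose ξ _ _ (norm_ne_zero_iff.1 (by rw [hξ]; exact one_ne_zero)) hΦ.le
      ((norm_inclusionInDoubleDual x).trans hx).le ?_
    rw [hξ, dual_def]
    linarith [(max_lt_iff.1 hΦξ).2, (max_lt_iff.1 hξx).2]
  intro Φ
  rcases eq_or_ne Φ 0 with rfl | hΦ
  · exact ⟨0, map_zero _⟩
  · obtain ⟨x, hx⟩ := hunit (‖Φ‖⁻¹ • Φ) (norm_inv_norm_smul (x := Φ) hΦ)
    refine ⟨‖Φ‖ • x, ?_⟩
    rw [map_smul, hx, smul_inv_smul₀ ((norm_ne_zero_iff (a := Φ)).2 hΦ)]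

theorem inclusionInDoubleDual_dualitySelDual_mem
    (hrefl : Function.Surjective (inclusionInDoubleDual ℝ X)) (hp : 1 < p)
    (ξ : StrongDual ℝ X) :
    inclusionInDoubleDual ℝ X (dualitySelDual p ξ) ∈ dualityMap p ξ := by
  obtain ⟨Φ, hΦ⟩ := dualityMap_nonempty hp ξ
  obtain ⟨x, rfl⟩ := hrefl Φ
  exact Classical.epsilon_spec (p := fun x => inclusionInDoubleDual ℝ X x ∈ dualityMap p ξ)
    ⟨x, hΦ⟩

theorem IsUniformlySmooth.dualitySel_dualitySelDual (hX : IsUniformlySmooth X)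
    (hrefl : Function.Surjective (inclusionInDoubleDual ℝ X)) (hpp' : p.HolderConjugate p')
    (ξ : StrongDual ℝ X) : dualitySel p (dualitySelDual p' ξ) = ξ :=
  hX.dualitySel_eq hpp'.lt ((inclusionInDoubleDual_mem_dualityMap_iff hpp').1
    (inclusionInDoubleDual_dualitySelDual_mem hrefl hpp'.symm.lt ξ))

theorem IsUniformlySmooth.continuous_dualitySelDual (hX : IsUniformlySmooth (StrongDual ℝ X))
    (hrefl : Function.Surjective (inclusionInDoubleDual ℝ X)) (hp : 1 < p) :
    Continuous (dualitySelDual p : StrongDual ℝ X → X) := by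
  rw [(inclusionInDoubleDualLi (E := X) ℝ).isometry.isEmbedding.continuous_iff]
  exact (hX.continuous_dualitySel hp).congr fun ξ =>
    hX.dualitySel_eq hp (inclusionInDoubleDual_dualitySelDual_mem hrefl hp ξ)

theorem IsPowerSmooth.bregman_dualitySelDual_add_le (hX : IsUniformlySmooth X)
    (hdual : IsPowerSmooth p' c (StrongDual ℝ X)) (hpp' : p.HolderConjugate p') (hc : 0 ≤ c)
    (hrefl : Function.Surjective (inclusionInDoubleDual ℝ X)) (x w : X) (ζ : StrongDual ℝ X) :
    bregman p (dualitySelDual p' (dualitySel p x + ζ)) w ≤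
      bregman p x w + ζ (x - w) + c * ‖ζ‖ ^ p' := by
  have hinv : dualitySel p' (dualitySel p x) = inclusionInDoubleDual ℝ X x :=
    (hdual.isUniformlySmooth hpp'.symm hc).dualitySel_eq hpp'.symm.lt
      ((inclusionInDoubleDual_mem_dualityMap_iff hpp').2 (dualitySel_mem hpp'.lt x))
  have hnorm (z : X) : ‖dualitySel p z‖ ^ p' = ‖z‖ ^ p := by
    rw [norm_dualitySel hpp'.lt, rpow_sub_one_rpow hpp' (norm_nonneg z)]
  have hstep := hX.dualitySel_dualitySelDual hrefl hpp' (dualitySel p x + ζ)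
  have hbound := hdual (dualitySel p x) (dualitySel p x + ζ)
  set x' := dualitySelDual p' (dualitySel p x + ζ)
  rw [bregman_eq_sub hpp'.symm, hinv, dual_def, add_sub_cancel_left, ← hstep, hnorm, hnorm]
    at hbound
  rw [bregman_eq hpp', bregman_eq hpp', hstep, add_apply, map_sub]
  linarith

theorem mem_topologicalClosure_of_forall_apply_eq_zero
    (hrefl : Function.Surjective (inclusionInDoubleDual ℝ X))
    {W : Submodule ℝ (StrongDual ℝ X)} {ζ : StrongDual ℝ X}
    (hζ : ∀ x, (∀ f ∈ W, f x = 0) → ζ x = 0) : ζ ∈ W.topologicalClosure := by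
  by_contra hnot
  obtain ⟨Φ, u, hΦζ, hu⟩ := geometric_hahn_banach_point_closed W.topologicalClosure.convex
    W.isClosed_topologicalClosure hnot
  have hu₀ : u < 0 := by simpa using hu 0 (Submodule.zero_mem _)
  obtain ⟨x, rfl⟩ := hrefl Φ
  have hvanish : ∀ f ∈ W, f x = 0 := fun f hf => by
    by_contra hfx
    have hscaled := hu (((u - 1) / f x) • f) (W.le_topologicalClosure (W.smul_mem _ hf))
    rw [dual_def, smul_apply, smul_eq_mul, div_mul_cancel₀ _ hfx] at hscaled
    linarith
  rw [dual_def, hζ x hvanish] at hΦζ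
  exact hΦζ.not_gt hu₀

theorem exists_norm_sub_sum_comp_le (hrefl : Function.Surjective (inclusionInDoubleDual ℝ X))
    {ι : Type*} [Fintype ι] {Y : ι → Type*} [∀ i, NormedAddCommGroup (Y i)]
    [∀ i, NormedSpace ℝ (Y i)] (A : ∀ i, X →L[ℝ] Y i) {ζ : StrongDual ℝ X}
    (hζ : ∀ x, (∀ i, A i x = 0) → ζ x = 0) {ε : ℝ} (hε : 0 < ε) :
    ∃ η : ∀ i, StrongDual ℝ (Y i), ‖ζ - ∑ i, (η i).comp (A i)‖ ≤ ε := by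
  classical
  let adjoint (i : ι) : StrongDual ℝ (Y i) →ₗ[ℝ] StrongDual ℝ X :=
    ((ContinuousLinearMap.compL ℝ X (Y i) ℝ).flip (A i)).toLinearMap
  have hmem : ζ ∈ (LinearMap.range (LinearMap.lsum ℝ _ ℝ adjoint)).topologicalClosure := by
    refine mem_topologicalClosure_of_forall_apply_eq_zero hrefl fun x hx => hζ x fun i => ?_
    refine SeparatingDual.eq_zero_of_forall_dual_eq_zero (R := ℝ) fun f => ?_
    simpa [adjoint] using hx _ ⟨Pi.single i f, LinearMap.lsum_piSingle ℝ _ ℝ adjoint i f⟩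
  obtain ⟨_, ⟨η, rfl⟩, hη⟩ := Metric.mem_closure_iff.1 hmem ε hε
  rw [dist_eq_norm, LinearMap.lsum_apply, LinearMap.sum_apply] at hη
  exact ⟨η, hη.le⟩

end Reflexive

section TangentialCone

variable {X Y : Type*} [NormedAddCommGroup X] [NormedSpace ℝ X] [NormedAddCommGroup Y]
  [NormedSpace ℝ Y]

/-- The tangential cone condition on `S`: the linearization error of `f`, with `f' x` in the role of
the derivative at `x`, is at most `γ` times the increment of `f`. -/
def TangentialCone (γ : ℝ) (f : X → Y) (f' : X → X →L[ℝ] Y) (S : Set X) : Prop :=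
  ∀ x ∈ S, ∀ x' ∈ S, ‖f x - f x' - f' x (x - x')‖ ≤ γ * ‖f x - f x'‖

namespace TangentialCone

variable {γ δ : ℝ} {f : X → Y} {f' : X → X →L[ℝ] Y} {S : Set X} {x x' : X}

theorem norm_deriv_apply_le (h : TangentialCone γ f f' S) (hx : x ∈ S) (hx' : x' ∈ S) :
    ‖f' x (x - x')‖ ≤ (1 + γ) * ‖f x - f x'‖ := by
  linarith [h x hx x' hx', norm_sub_norm_le (f' x (x - x')) (f x - f x'),
    norm_sub_rev (f' x (x - x')) (f x - f x')]

theorem eq_of_deriv_apply_eq_zero (h : TangentialCone γ f f' S) (hγ : γ < 1) (hx : x ∈ S)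
    (hx' : x' ∈ S) (hker : f' x (x - x') = 0) : f x = f x' := by
  have hle := h x hx x' hx'
  rw [hker, sub_zero] at hle
  rw [← sub_eq_zero, ← norm_le_zero_iff]
  nlinarith

theorem norm_deriv_apply_sub_le (h : TangentialCone γ f f' S) (hγ : 0 ≤ γ) {u w : X} (hx : x ∈ S)
    (hu : u ∈ S) (hw : w ∈ S) :
    ‖f' x (u - w)‖ ≤ (1 + γ) * (2 * ‖f x - f w‖ + ‖f u - f w‖) := by
  calc ‖f' x (u - w)‖ = ‖f' x (x - w) - f' x (x - u)‖ := by rw [← map_sub, sub_sub_sub_cancel_left]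
    _ ≤ (1 + γ) * ‖f x - f w‖ + (1 + γ) * ‖f x - f u‖ :=
      (norm_sub_le _ _).trans
        (add_le_add (h.norm_deriv_apply_le hx hw) (h.norm_deriv_apply_le hx hu))
    _ ≤ (1 + γ) * ‖f x - f w‖ + (1 + γ) * (‖f x - f w‖ + ‖f u - f w‖) := by
      gcongr
      rw [← sub_sub_sub_cancel_right (f x) (f u) (f w)]
      exact norm_sub_le _ _
    _ = (1 + γ) * (2 * ‖f x - f w‖ + ‖f u - f w‖) := by ring

theorem norm_noisy_sub_deriv_apply_le (h : TangentialCone γ f f' S) (hγ : 0 ≤ γ) {b : Y}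
    (hx : x ∈ S) (hx' : x' ∈ S) (hb : ‖f x' - b‖ ≤ δ) :
    ‖f x - b - f' x (x - x')‖ ≤ γ * ‖f x - b‖ + (1 + γ) * δ := by
  have hdata : ‖f x - f x'‖ ≤ ‖f x - b‖ + δ := by
    rw [← sub_sub_sub_cancel_right (f x) (f x') b]
    exact (norm_sub_le _ _).trans (by gcongr)
  calc ‖f x - b - f' x (x - x')‖ = ‖(f x - f x' - f' x (x - x')) + (f x' - b)‖ := by
        congr 1
        abel
    _ ≤ γ * ‖f x - f x'‖ + δ := (norm_add_le _ _).trans (add_le_add (h x hx x' hx') hb)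
    _ ≤ γ * (‖f x - b‖ + δ) + δ := by gcongr
    _ = γ * ‖f x - b‖ + (1 + γ) * δ := by ring

end TangentialCone

end TangentialCone

section Residual

variable {X : Type*} {N : ℕ} {Y : Fin N → Type*} [∀ i, NormedAddCommGroup (Y i)] {p : ℝ}

/-- The residual of the system `F i x = y i`: the sum of the `p`-th powers of the residuals of the
single equations. -/
noncomputable def residual (p : ℝ) (F : ∀ i, X → Y i) (y : ∀ i, Y i) (x : X) : ℝ :=
  ∑ i, ‖F i x - y i‖ ^ p

theorem residual_nonneg (F : ∀ i, X → Y i) (y : ∀ i, Y i) (x : X) : 0 ≤ residual p F y x :=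
  Finset.sum_nonneg fun _ _ => by positivity

theorem norm_rpow_le_residual (F : ∀ i, X → Y i) (y : ∀ i, Y i) (x : X) (i : Fin N) :
    ‖F i x - y i‖ ^ p ≤ residual p F y x :=
  Finset.single_le_sum (f := fun i => ‖F i x - y i‖ ^ p) (fun _ _ => by positivity)
    (Finset.mem_univ i)

end Residual

section Setting

/-- The assumptions of the convergence analysis which do not involve the step sizes: the geometry of
the spaces, the exponents, the operators and the reference solution. The constant `c` bounds the
Bregman distance of the dual space and `Λ` the derivatives of all operators. -/
structure SGDSetting {X : Type*} [NormedAddCommGroup X] [NormedSpace ℝ X] {N : ℕ}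
    {Y : Fin N → Type*} [∀ i, NormedAddCommGroup (Y i)] [∀ i, NormedSpace ℝ (Y i)]
    (p p' c γ Λ ν : ℝ) (F : ∀ i, X → Y i) (F' : ∀ i, X → X →L[ℝ] Y i) (y : ∀ i, Y i) (S : Set X)
    (x₀ xs : X) : Prop where
  conj : p.HolderConjugate p'
  smooth : IsUniformlySmooth X
  smooth_codomain : ∀ i, IsUniformlySmooth (Y i)
  c_nonneg : 0 ≤ c
  powerSmooth_dual : IsPowerSmooth p' c (StrongDual ℝ X)
  isSolution : IsMinDistSolution p S F y x₀ xs
  γ_nonneg : 0 ≤ γ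
  γ_lt_one : γ < 1
  bregman_lt : bregman p x₀ xs < ν
  ball_subset : bregmanBall p ν xs ⊆ S
  continuousOn : ∀ i, ContinuousOn (F i) S
  continuousOn_deriv : ∀ i, ContinuousOn (F' i) S
  norm_deriv_le : ∀ i, ∀ x ∈ S, ‖F' i x‖ ≤ Λ
  cone : ∀ i, TangentialCone γ (F i) (F' i) S
  null : ∀ x ∈ S, ∀ h : X, (∀ i, F' i xs h = 0) → ∀ i, F' i x h = 0

/-- Positivity and smallness of the step sizes `μ 1, μ 2, ...`; `C` is the guaranteed rate of
decrease of the Bregman distance per step. -/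
structure IsAdmissibleStepSize (p' c γ Λ C : ℝ) (μ : ℕ → ℝ) : Prop where
  C_pos : 0 < C
  pos : ∀ l, 1 ≤ l → 0 < μ l
  le : ∀ l, 1 ≤ l → C ≤ 1 - γ - Λ ^ p' * c * μ l ^ (p' - 1)

/-- The factor of `δ ^ p * μ` in the error which data noise of level `δ` causes in one step of size
`μ`. It is the constant of Young's inequality which absorbs the noise into `C / 2` times the
residual. -/
noncomputable def noiseConst (p γ C : ℝ) : ℝ := (1 + γ) ^ p / (C / 2) ^ (p - 1)

theorem noiseConst_nonneg {p γ C : ℝ} (hγ : 0 ≤ γ) (hC : 0 < C) : 0 ≤ noiseConst p γ C := by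
  unfold noiseConst
  positivity

variable {X : Type*} [NormedAddCommGroup X] [NormedSpace ℝ X]
  {N : ℕ} {Y : Fin N → Type*} [∀ i, NormedAddCommGroup (Y i)] [∀ i, NormedSpace ℝ (Y i)]
  {p p' c γ Λ ν C δ : ℝ} {F : ∀ i, X → Y i} {F' : ∀ i, X → X →L[ℝ] Y i}
  {y b : ∀ i, Y i} {S : Set X} {x₀ xs x : X} {μ : ℕ → ℝ}

namespace SGDSetting

theorem smooth_dual (H : SGDSetting p p' c γ Λ ν F F' y S x₀ xs) :
    IsUniformlySmooth (StrongDual ℝ X) :=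
  H.powerSmooth_dual.isUniformlySmooth H.conj.symm H.c_nonneg

theorem surjective_inclusionInDoubleDual [CompleteSpace X]
    (H : SGDSetting p p' c γ Λ ν F F' y S x₀ xs) :
    Function.Surjective (NormedSpace.inclusionInDoubleDual ℝ X) :=
  surjective_inclusionInDoubleDual_of_isUniformlySmooth_dual H.smooth_dual

theorem mem_nhds (H : SGDSetting p p' c γ Λ ν F F' y S x₀ xs) : S ∈ 𝓝 xs := by
  have hν : 0 < ν := (bregman_nonneg H.conj x₀ xs).trans_lt H.bregman_lt
  have hcont := (H.smooth.continuous_bregman_left H.conj xs).tendsto xs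
  rw [bregman_self H.conj] at hcont
  exact mem_of_superset (hcont.eventually (gt_mem_nhds hν)) fun z
    (hz : bregman p z xs < ν) => H.ball_subset hz.le

theorem dualitySel_sub_apply_eq_zero (H : SGDSetting p p' c γ Λ ν F F' y S x₀ xs) {h : X}
    (hh : ∀ i, F' i xs h = 0) : (dualitySel p x₀ - dualitySel p xs) h = 0 := by
  have hle {v : X} (hv : ∀ i, F' i xs v = 0) : dualitySel p x₀ v ≤ dualitySel p xs v := by
    refine H.smooth.dualitySel_apply_le_of_eventually_bregman_le H.conj ?_
    have hline : Tendsto (fun t : ℝ => xs + t • v) (𝓝[>] 0) (𝓝 xs) := by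
      have hcont : Continuous fun t : ℝ => xs + t • v := by fun_prop
      simpa using (hcont.tendsto 0).mono_left nhdsWithin_le_nhds
    filter_upwards [hline.eventually H.mem_nhds] with t htS
    refine H.isSolution.2.2 _ htS fun i => ?_
    rw [← H.isSolution.2.1 i]
    refine ((H.cone i).eq_of_deriv_apply_eq_zero H.γ_lt_one H.isSolution.1 htS ?_).symm
    rw [sub_add_cancel_left, map_neg, map_smul, hv i, smul_zero, neg_zero]
  have hneg := hle (v := -h) fun i => by rw [map_neg, hh i, neg_zero]
  rw [map_neg, map_neg] at hneg
  rw [sub_apply]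
  linarith [hle hh]

theorem sum_comp_deriv_apply_sub_le (H : SGDSetting p p' c γ Λ ν F F' y S x₀ xs)
    (η : ∀ i, StrongDual ℝ (Y i)) {t : ℝ} (ht : 0 < t) (hx : x ∈ S) :
    (∑ i, (η i).comp (F' i xs)) (x - xs) ≤
      (∑ i, ‖η i‖ * (1 + γ)) * (t + residual p F y x / t ^ (p - 1)) := by
  have hγ := H.γ_nonneg
  have hderiv (i : Fin N) : ‖F' i xs (x - xs)‖ ≤ (1 + γ) * ‖F i x - y i‖ := by
    have := (H.cone i).norm_deriv_apply_le H.isSolution.1 hx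
    rwa [← neg_sub, map_neg, norm_neg, norm_sub_rev, H.isSolution.2.1 i] at this
  rw [sum_apply, Finset.sum_mul]
  refine Finset.sum_le_sum fun i _ => ?_
  calc η i (F' i xs (x - xs)) ≤ ‖η i‖ * ‖F' i xs (x - xs)‖ :=
        (le_abs_self _).trans ((η i).le_opNorm _)
    _ ≤ ‖η i‖ * ((1 + γ) * ‖F i x - y i‖) := by gcongr; exact hderiv i
    _ ≤ ‖η i‖ * ((1 + γ) * (t + ‖F i x - y i‖ ^ p / t ^ (p - 1))) := by
      gcongr
      exact le_add_rpow_div H.conj.lt (norm_nonneg _) ht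
    _ ≤ ‖η i‖ * (1 + γ) * (t + residual p F y x / t ^ (p - 1)) := by
      rw [← mul_assoc]
      gcongr
      exact norm_rpow_le_residual F y x i

theorem exists_apply_sub_le_add_residual [CompleteSpace X]
    (H : SGDSetting p p' c γ Λ ν F F' y S x₀ xs) {ζ : StrongDual ℝ X}
    (hζ : ∀ h, (∀ i, F' i xs h = 0) → ζ h = 0) (B : ℝ) {ε : ℝ} (hε : 0 < ε) :
    ∃ Q : ℝ, ∀ x ∈ S, ‖x - xs‖ ≤ B → ζ (x - xs) ≤ ε + Q * residual p F y x := by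
  have hγ := H.γ_nonneg
  obtain ⟨η, hη⟩ := exists_norm_sub_sum_comp_le H.surjective_inclusionInDoubleDual
    (fun i => F' i xs) hζ (show 0 < ε / 2 / (|B| + 1) by positivity)
  set W := ∑ i, ‖η i‖ * (1 + γ)
  have : 0 ≤ W := Finset.sum_nonneg fun i _ => by positivity
  set t := ε / 2 / (W + 1) with ht
  refine ⟨W / t ^ (p - 1), fun x hx hxB => ?_⟩
  have hrange := H.sum_comp_deriv_apply_sub_le η (show 0 < t by positivity) hx
  have hWt : W * t ≤ ε / 2 := by
    rw [ht, mul_div_left_comm]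
    exact mul_le_of_le_one_right (by positivity) (div_le_one_of_le₀ (by linarith) (by positivity))
  have happrox : (ζ - ∑ i, (η i).comp (F' i xs)) (x - xs) ≤ ε / 2 :=
    calc _ ≤ ε / 2 / (|B| + 1) * ‖x - xs‖ :=
          (le_abs_self _).trans (ContinuousLinearMap.le_of_opNorm_le _ hη _)
      _ ≤ ε / 2 / (|B| + 1) * (|B| + 1) := by
        gcongr
        linarith [le_abs_self B]
      _ = ε / 2 := div_mul_cancel₀ _ (by positivity)
  rw [sub_apply] at happrox
  have hsplit : W * (t + residual p F y x / t ^ (p - 1)) =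
      W * t + W / t ^ (p - 1) * residual p F y x := by ring
  linarith

theorem norm_smul_sgdGradient_rpow_le (H : SGDSetting p p' c γ Λ ν F F' y S x₀ xs) (hx : x ∈ S)
    {m : ℝ} (hm : 0 ≤ m) (j : Fin N) :
    ‖m • sgdGradient p F F' b x j‖ ^ p' ≤ Λ ^ p' * m ^ (p' - 1) * (m * ‖F j x - b j‖ ^ p) := by
  have hΛ : 0 ≤ Λ := (norm_nonneg _).trans (H.norm_deriv_le j x hx)
  have hgrad : ‖sgdGradient p F F' b x j‖ ≤ ‖F j x - b j‖ ^ (p - 1) * Λ := by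
    rw [← norm_dualitySel H.conj.lt]
    exact (ContinuousLinearMap.opNorm_comp_le _ _).trans (by gcongr; exact H.norm_deriv_le j x hx)
  calc ‖m • sgdGradient p F F' b x j‖ ^ p' ≤ (m * (‖F j x - b j‖ ^ (p - 1) * Λ)) ^ p' := by
        have := H.conj.symm.nonneg
        rw [norm_smul, Real.norm_of_nonneg hm]
        gcongr
    _ = m ^ p' * (‖F j x - b j‖ ^ p * Λ ^ p') := by
        rw [Real.mul_rpow hm (by positivity), Real.mul_rpow (by positivity) hΛ,
          rpow_sub_one_rpow H.conj (norm_nonneg _)]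
    _ = Λ ^ p' * m ^ (p' - 1) * (m * ‖F j x - b j‖ ^ p) := by
        rw [← mul_rpow_sub_one_self hm H.conj.symm.ne_zero]
        ring

theorem le_sgdGradient_apply_sub (H : SGDSetting p p' c γ Λ ν F F' y S x₀ xs) (hx : x ∈ S)
    {j : Fin N} (hb : ‖y j - b j‖ ≤ δ) :
    (1 - γ) * ‖F j x - b j‖ ^ p - ‖F j x - b j‖ ^ (p - 1) * ((1 + γ) * δ) ≤
      sgdGradient p F F' b x j (x - xs) := by
  rw [← H.isSolution.2.1 j] at hb
  set r := F j x - b j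
  have hlin : ‖r - F' j x (x - xs)‖ ≤ γ * ‖r‖ + (1 + γ) * δ :=
    (H.cone j).norm_noisy_sub_deriv_apply_le H.γ_nonneg hx H.isSolution.1 hb
  have herror : dualitySel p r (r - F' j x (x - xs)) ≤
      ‖r‖ ^ (p - 1) * (γ * ‖r‖ + (1 + γ) * δ) := by
    exact (dualitySel_apply_le H.conj.lt _ _).trans (by gcongr)
  have hsplit : sgdGradient p F F' b x j (x - xs) =
      ‖r‖ ^ p - dualitySel p r (r - F' j x (x - xs)) := by
    rw [← dualitySel_apply_self H.conj.lt r, ← map_sub, sub_sub_cancel]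
    rfl
  have hpow := mul_rpow_sub_one_self (norm_nonneg r) H.conj.ne_zero
  rw [hsplit]
  linear_combination herror + γ * hpow

theorem bregman_step_le [CompleteSpace X] (H : SGDSetting p p' c γ Λ ν F F' y S x₀ xs)
    (hμ : IsAdmissibleStepSize p' c γ Λ C μ) (hx : x ∈ S) {j : Fin N} (hb : ‖y j - b j‖ ≤ δ)
    {k : ℕ} (hk : 1 ≤ k) :
    bregman p (dualitySelDual p' (dualitySel p x - μ k • sgdGradient p F F' b x j)) xs ≤
      bregman p x xs - C / 2 * (μ k * ‖F j x - b j‖ ^ p) + noiseConst p γ C * (δ ^ p * μ k) := by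
  have hδ : 0 ≤ δ := (norm_nonneg _).trans hb
  have hγ := H.γ_nonneg
  have hμk := (hμ.pos k hk).le
  set r := F j x - b j
  set g := sgdGradient p F F' b x j
  have hdescent := H.powerSmooth_dual.bregman_dualitySelDual_add_le H.smooth H.conj H.c_nonneg
    H.surjective_inclusionInDoubleDual x xs (-(μ k • g))
  rw [← sub_eq_add_neg, norm_neg, neg_apply, smul_apply, smul_eq_mul] at hdescent
  have hquad : c * ‖μ k • g‖ ^ p' ≤ Λ ^ p' * c * μ k ^ (p' - 1) * (μ k * ‖r‖ ^ p) :=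
    (mul_le_mul_of_nonneg_left (H.norm_smul_sgdGradient_rpow_le hx hμk j) H.c_nonneg).trans_eq
      (by ring)
  have hlin := mul_le_mul_of_nonneg_left (H.le_sgdGradient_apply_sub hx hb) hμk
  have hnoise : ‖r‖ ^ (p - 1) * ((1 + γ) * δ) ≤ C / 2 * ‖r‖ ^ p + noiseConst p γ C * δ ^ p := by
    refine (rpow_sub_one_mul_le H.conj.lt (norm_nonneg r) (by positivity)
      (half_pos hμ.C_pos)).trans_eq ?_
    rw [Real.mul_rpow (by positivity) hδ, noiseConst]
    ring
  have hsmall := mul_le_mul_of_nonneg_right (hμ.le k hk) (by positivity : 0 ≤ μ k * ‖r‖ ^ p)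
  linear_combination hdescent + hquad + hlin + μ k * hnoise + hsmall

theorem sgdIterate_succ (H : SGDSetting p p' c γ Λ ν F F' y S x₀ xs) (b : ∀ i, Y i)
    (μ : ℕ → ℝ) (i : ℕ → Fin N) (n : ℕ) :
    sgdIterate p F F' b μ x₀ i (n + 1) = dualitySelDual p'
      (dualitySel p (sgdIterate p F F' b μ x₀ i n) -
        μ (n + 1) • sgdGradient p F F' b (sgdIterate p F F' b μ x₀ i n) (i (n + 1))) := by
  rw [sgdIterate, H.conj.conjExponent_eq]

theorem dualitySel_sgdIterate_succ [CompleteSpace X]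
    (H : SGDSetting p p' c γ Λ ν F F' y S x₀ xs) (b : ∀ i, Y i) (μ : ℕ → ℝ) (i : ℕ → Fin N)
    (n : ℕ) :
    dualitySel p (sgdIterate p F F' b μ x₀ i (n + 1)) =
      dualitySel p (sgdIterate p F F' b μ x₀ i n) -
        μ (n + 1) • sgdGradient p F F' b (sgdIterate p F F' b μ x₀ i n) (i (n + 1)) := by
  rw [H.sgdIterate_succ,
    H.smooth.dualitySel_dualitySelDual H.surjective_inclusionInDoubleDual H.conj]

theorem bregman_sgdIterate_succ_le [CompleteSpace X]
    (H : SGDSetting p p' c γ Λ ν F F' y S x₀ xs) (hμ : IsAdmissibleStepSize p' c γ Λ C μ)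
    (hb : ∀ j, ‖y j - b j‖ ≤ δ) {i : ℕ → Fin N} {k : ℕ}
    (hk : sgdIterate p F F' b μ x₀ i k ∈ S) :
    bregman p (sgdIterate p F F' b μ x₀ i (k + 1)) xs ≤
      bregman p (sgdIterate p F F' b μ x₀ i k) xs -
        C / 2 * (μ (k + 1) *
          ‖F (i (k + 1)) (sgdIterate p F F' b μ x₀ i k) - b (i (k + 1))‖ ^ p) +
        noiseConst p γ C * (δ ^ p * μ (k + 1)) := by
  rw [H.sgdIterate_succ]
  exact H.bregman_step_le hμ hk (hb _) k.succ_pos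

theorem bregman_sgdIterate_le_add_sum_Ico [CompleteSpace X]
    (H : SGDSetting p p' c γ Λ ν F F' y S x₀ xs) (hμ : IsAdmissibleStepSize p' c γ Λ C μ)
    (hb : ∀ j, ‖y j - b j‖ ≤ δ) {i : ℕ → Fin N} {l k : ℕ} (hlk : l ≤ k)
    (hS : ∀ m < k, sgdIterate p F F' b μ x₀ i m ∈ S) :
    bregman p (sgdIterate p F F' b μ x₀ i k) xs ≤
      bregman p (sgdIterate p F F' b μ x₀ i l) xs +
        noiseConst p γ C * (δ ^ p * ∑ m ∈ Finset.Ico l k, μ (m + 1)) := by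
  induction k, hlk using Nat.le_induction with
  | base => simp
  | succ k hk ih =>
    have hstep := H.bregman_sgdIterate_succ_le hμ hb (hS k k.lt_succ_self)
    have hdecrease : 0 ≤ C / 2 * (μ (k + 1) *
        ‖F (i (k + 1)) (sgdIterate p F F' b μ x₀ i k) - b (i (k + 1))‖ ^ p) := by
      have := hμ.C_pos
      have := hμ.pos (k + 1) k.succ_pos
      positivity
    rw [Finset.sum_Ico_succ_top hk]
    linarith [ih fun m hm => hS m (hm.trans k.lt_succ_self)]

theorem bregman_sgdIterate_le_add_sum_range [CompleteSpace X]
    (H : SGDSetting p p' c γ Λ ν F F' y S x₀ xs) (hμ : IsAdmissibleStepSize p' c γ Λ C μ)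
    (hb : ∀ j, ‖y j - b j‖ ≤ δ) {i : ℕ → Fin N} {l k n : ℕ} (hlk : l ≤ k) (hkn : k ≤ n)
    (hS : ∀ m < k, sgdIterate p F F' b μ x₀ i m ∈ S) :
    bregman p (sgdIterate p F F' b μ x₀ i k) xs ≤
      bregman p (sgdIterate p F F' b μ x₀ i l) xs +
        noiseConst p γ C * (δ ^ p * ∑ m ∈ Finset.range n, μ (m + 1)) := by
  have hδ : 0 ≤ δ := (norm_nonneg _).trans (hb (i 0))
  have hK := noiseConst_nonneg (p := p) H.γ_nonneg hμ.C_pos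
  have hsum : ∑ m ∈ Finset.Ico l k, μ (m + 1) ≤ ∑ m ∈ Finset.range n, μ (m + 1) := by
    refine Finset.sum_le_sum_of_subset_of_nonneg (fun m hm => ?_)
      fun m _ _ => (hμ.pos (m + 1) m.succ_pos).le
    exact Finset.mem_range.2 ((Finset.mem_Ico.1 hm).2.trans_le hkn)
  exact (H.bregman_sgdIterate_le_add_sum_Ico hμ hb hlk hS).trans (by gcongr)

theorem bregman_sgdIterate_le [CompleteSpace X] (H : SGDSetting p p' c γ Λ ν F F' y S x₀ xs)
    (hμ : IsAdmissibleStepSize p' c γ Λ C μ) (hb : ∀ j, ‖y j - b j‖ ≤ δ) (i : ℕ → Fin N) {n : ℕ}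
    (hn : bregman p x₀ xs +
      noiseConst p γ C * (δ ^ p * ∑ m ∈ Finset.range n, μ (m + 1)) ≤ ν) {k : ℕ} (hk : k ≤ n) :
    bregman p (sgdIterate p F F' b μ x₀ i k) xs ≤ ν := by
  induction k using Nat.strong_induction_on with
  | h k ih =>
    exact (H.bregman_sgdIterate_le_add_sum_range hμ hb k.zero_le hk
      fun m hm => H.ball_subset (ih m hm (hm.le.trans hk))).trans hn

theorem sgdIterate_exact_mem [CompleteSpace X] (H : SGDSetting p p' c γ Λ ν F F' y S x₀ xs)
    (hμ : IsAdmissibleStepSize p' c γ Λ C μ) (i : ℕ → Fin N) (k : ℕ) :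
    sgdIterate p F F' y μ x₀ i k ∈ S := by
  refine H.ball_subset
    (H.bregman_sgdIterate_le hμ (δ := 0) (fun j => by rw [sub_self, norm_zero]) i ?_ le_rfl)
  rw [Real.zero_rpow H.conj.ne_zero, zero_mul, mul_zero, add_zero]
  exact H.bregman_lt.le

theorem mul_norm_rpow_le_bregman_sub_exact [CompleteSpace X]
    (H : SGDSetting p p' c γ Λ ν F F' y S x₀ xs) (hμ : IsAdmissibleStepSize p' c γ Λ C μ)
    (i : ℕ → Fin N) (k : ℕ) :
    C / 2 * (μ (k + 1) *
        ‖F (i (k + 1)) (sgdIterate p F F' y μ x₀ i k) - y (i (k + 1))‖ ^ p) ≤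
      bregman p (sgdIterate p F F' y μ x₀ i k) xs -
        bregman p (sgdIterate p F F' y μ x₀ i (k + 1)) xs := by
  have hstep := H.bregman_sgdIterate_succ_le hμ (δ := 0)
    (fun j => by rw [sub_self, norm_zero]) (H.sgdIterate_exact_mem hμ i k)
  rw [Real.zero_rpow H.conj.ne_zero, zero_mul, mul_zero, add_zero] at hstep
  linarith

theorem bregman_sgdIterate_exact_le [CompleteSpace X]
    (H : SGDSetting p p' c γ Λ ν F F' y S x₀ xs) (hμ : IsAdmissibleStepSize p' c γ Λ C μ)
    (i : ℕ → Fin N) (k : ℕ) :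
    bregman p (sgdIterate p F F' y μ x₀ i k) xs ≤ bregman p x₀ xs := by
  have hle := H.bregman_sgdIterate_le_add_sum_range hμ (δ := 0)
    (fun j => by rw [sub_self, norm_zero]) k.zero_le le_rfl
    fun m _ => H.sgdIterate_exact_mem hμ i m
  rwa [Real.zero_rpow H.conj.ne_zero, zero_mul, mul_zero, add_zero] at hle

theorem dualitySel_sgdIterate_sub_apply_eq_zero [CompleteSpace X]
    (H : SGDSetting p p' c γ Λ ν F F' y S x₀ xs) {i : ℕ → Fin N} {n : ℕ}
    (hS : ∀ m < n, sgdIterate p F F' b μ x₀ i m ∈ S) {h : X} (hh : ∀ j, F' j xs h = 0) :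
    (dualitySel p (sgdIterate p F F' b μ x₀ i n) - dualitySel p xs) h = 0 := by
  induction n with
  | zero => exact H.dualitySel_sub_apply_eq_zero hh
  | succ n ih =>
    have hgrad : sgdGradient p F F' b (sgdIterate p F F' b μ x₀ i n) (i (n + 1)) h = 0 := by
      rw [sgdGradient, ContinuousLinearMap.comp_apply, H.null _ (hS n n.lt_succ_self) h hh,
        map_zero]
    rw [H.dualitySel_sgdIterate_succ, sub_right_comm, sub_apply, smul_apply, hgrad, smul_zero,
      sub_zero, ih fun m hm => hS m (hm.trans n.lt_succ_self)]

theorem dualitySel_sgdIterate_sub_eq_sum [CompleteSpace X]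
    (H : SGDSetting p p' c γ Λ ν F F' y S x₀ xs) (b : ∀ i, Y i) (μ : ℕ → ℝ) (i : ℕ → Fin N)
    {l k : ℕ} (hlk : l ≤ k) :
    dualitySel p (sgdIterate p F F' b μ x₀ i k) - dualitySel p (sgdIterate p F F' b μ x₀ i l) =
      -∑ m ∈ Finset.Ico l k,
        μ (m + 1) • sgdGradient p F F' b (sgdIterate p F F' b μ x₀ i m) (i (m + 1)) := by
  rw [← Finset.sum_Ico_sub (fun k => dualitySel p (sgdIterate p F F' b μ x₀ i k)) hlk,
    ← Finset.sum_neg_distrib]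
  exact Finset.sum_congr rfl fun m _ => by rw [H.dualitySel_sgdIterate_succ, sub_sub_cancel_left]

theorem neg_sgdGradient_apply_sub_le (H : SGDSetting p p' c γ Λ ν F F' y S x₀ xs) {u : X}
    (hx : x ∈ S) (hu : u ∈ S) (j : Fin N) :
    -sgdGradient p F F' y x j (u - xs) ≤
      (1 + γ) * (3 * ‖F j x - y j‖ ^ p + residual p F y u) := by
  have hγ := H.γ_nonneg
  set r := F j x - y j with hr
  have hderiv : ‖F' j x (u - xs)‖ ≤ (1 + γ) * (2 * ‖r‖ + ‖F j u - y j‖) := by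
    rw [hr, ← H.isSolution.2.1 j]
    exact (H.cone j).norm_deriv_apply_sub_le hγ hx hu H.isSolution.1
  have hyoung : ‖r‖ ^ (p - 1) * ‖F j u - y j‖ ≤ ‖r‖ ^ p + ‖F j u - y j‖ ^ p := by
    simpa using rpow_sub_one_mul_le H.conj.lt (norm_nonneg r) (norm_nonneg (F j u - y j)) one_pos
  calc -sgdGradient p F F' y x j (u - xs) = dualitySel p r (-F' j x (u - xs)) :=
        (map_neg (dualitySel p r) _).symm
    _ ≤ ‖r‖ ^ (p - 1) * ((1 + γ) * (2 * ‖r‖ + ‖F j u - y j‖)) := by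
      refine (dualitySel_apply_le H.conj.lt _ _).trans ?_
      rw [norm_neg]
      gcongr
    _ = (1 + γ) * (2 * ‖r‖ ^ p + ‖r‖ ^ (p - 1) * ‖F j u - y j‖) := by
      rw [← mul_rpow_sub_one_self (norm_nonneg r) H.conj.ne_zero]
      ring
    _ ≤ (1 + γ) * (3 * ‖r‖ ^ p + residual p F y u) := by
      refine mul_le_mul_of_nonneg_left ?_ (by linarith)
      linarith [norm_rpow_le_residual (p := p) F y u j]

theorem dualitySel_sgdIterate_sub_apply_le [CompleteSpace X]
    (H : SGDSetting p p' c γ Λ ν F F' y S x₀ xs) (hμ : IsAdmissibleStepSize p' c γ Λ C μ)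
    (i : ℕ → Fin N) {l k : ℕ} (hlk : l ≤ k) :
    (dualitySel p (sgdIterate p F F' y μ x₀ i k) -
      dualitySel p (sgdIterate p F F' y μ x₀ i l)) (sgdIterate p F F' y μ x₀ i k - xs) ≤
      ∑ m ∈ Finset.Ico l k, μ (m + 1) * ((1 + γ) *
        (3 * ‖F (i (m + 1)) (sgdIterate p F F' y μ x₀ i m) - y (i (m + 1))‖ ^ p +
          residual p F y (sgdIterate p F F' y μ x₀ i k))) := by
  rw [H.dualitySel_sgdIterate_sub_eq_sum y μ i hlk, neg_apply, sum_apply,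
    ← Finset.sum_neg_distrib]
  refine Finset.sum_le_sum fun m _ => ?_
  rw [smul_apply, smul_eq_mul, ← mul_neg]
  exact mul_le_mul_of_nonneg_left (H.neg_sgdGradient_apply_sub_le (H.sgdIterate_exact_mem hμ i m)
    (H.sgdIterate_exact_mem hμ i k) (i (m + 1))) (hμ.pos (m + 1) m.succ_pos).le

end SGDSetting

theorem dependsOn_sgdIterate (F : ∀ i, X → Y i) (F' : ∀ i, X → X →L[ℝ] Y i) (b : ∀ i, Y i)
    (μ : ℕ → ℝ) (x₀ : X) (n : ℕ) :
    DependsOn (fun i => sgdIterate p F F' b μ x₀ i n) (Set.Icc 1 n) := by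
  intro i i' h
  induction n with
  | zero => rfl
  | succ n ih =>
    have hn : sgdIterate p F F' b μ x₀ i n = sgdIterate p F F' b μ x₀ i' n :=
      ih fun m hm => h m ⟨hm.1, hm.2.trans n.le_succ⟩
    simp only [sgdIterate, hn, h (n + 1) ⟨n.succ_pos, le_rfl⟩]

theorem finite_range_sgdIterate (F : ∀ i, X → Y i) (F' : ∀ i, X → X →L[ℝ] Y i) (b : ∀ i, Y i)
    (μ : ℕ → ℝ) (x₀ : X) (n : ℕ) :
    (Set.range fun i => sgdIterate p F F' b μ x₀ i n).Finite := by
  obtain ⟨g, hg⟩ := dependsOn_iff_exists_comp.1 (dependsOn_sgdIterate (p := p) F F' b μ x₀ n)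
  rw [hg]
  exact (Set.finite_range g).subset (Set.range_comp_subset_range _ _)

namespace SGDSetting

-- Splitting `J x_k - J xs` at the index `l`: the part `J x_l - J xs` annihilates the common null
-- space of the derivatives at `xs`, the rest is a sum of gradients.
theorem exists_bregman_sgdIterate_exact_le [CompleteSpace X]
    (H : SGDSetting p p' c γ Λ ν F F' y S x₀ xs) (hμ : IsAdmissibleStepSize p' c γ Λ C μ)
    (l : ℕ) {ε : ℝ} (hε : 0 < ε) :
    ∃ Q : ℝ, ∀ (i : ℕ → Fin N) (k : ℕ), l ≤ k →
      bregman p (sgdIterate p F F' y μ x₀ i k) xs ≤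
        ε + Q * residual p F y (sgdIterate p F F' y μ x₀ i k) +
        ∑ m ∈ Finset.Ico l k, μ (m + 1) * ((1 + γ) *
          (3 * ‖F (i (m + 1)) (sgdIterate p F F' y μ x₀ i m) - y (i (m + 1))‖ ^ p +
            residual p F y (sgdIterate p F F' y μ x₀ i k))) := by
  obtain ⟨B, hB⟩ := exists_norm_le_of_bregman_le H.conj xs (bregman p x₀ xs)
  have hstart : ∀ z ∈ Set.range fun i => sgdIterate p F F' y μ x₀ i l, ∃ Q : ℝ, ∀ x ∈ S,
      ‖x - xs‖ ≤ B + ‖xs‖ →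
        (dualitySel p z - dualitySel p xs) (x - xs) ≤ ε + Q * residual p F y x := by
    rintro _ ⟨i, rfl⟩
    exact H.exists_apply_sub_le_add_residual (fun h hh => H.dualitySel_sgdIterate_sub_apply_eq_zero
      (fun m _ => H.sgdIterate_exact_mem hμ i m) hh) _ hε
  choose! Q hQ using hstart
  obtain ⟨Q', hQ'⟩ := ((finite_range_sgdIterate F F' y μ x₀ l).image Q).bddAbove
  refine ⟨Q', fun i k hlk => ?_⟩
  set z := sgdIterate p F F' y μ x₀ i
  have hzk : ‖z k - xs‖ ≤ B + ‖xs‖ :=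
    (norm_sub_le _ _).trans (by gcongr; exact hB _ (H.bregman_sgdIterate_exact_le hμ i k))
  calc bregman p (z k) xs ≤ (dualitySel p (z k) - dualitySel p xs) (z k - xs) :=
        bregman_le_sub_apply_sub H.conj _ _
    _ = (dualitySel p (z l) - dualitySel p xs) (z k - xs) +
        (dualitySel p (z k) - dualitySel p (z l)) (z k - xs) := by
      simp only [sub_apply]
      ring
    _ ≤ ε + Q (z l) * residual p F y (z k) + _ :=
      add_le_add (hQ _ ⟨i, rfl⟩ _ (H.sgdIterate_exact_mem hμ i k) hzk)
        (H.dualitySel_sgdIterate_sub_apply_le hμ i hlk)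
    _ ≤ ε + Q' * residual p F y (z k) + _ := by
      have := hQ' ⟨z l, ⟨i, rfl⟩, rfl⟩
      have := residual_nonneg (p := p) F y (z k)
      gcongr

theorem tendsto_sgdIterate [CompleteSpace X] (H : SGDSetting p p' c γ Λ ν F F' y S x₀ xs)
    {ι : Type*} {𝓕 : Filter ι} {b : ι → ∀ i, Y i}
    (hb : ∀ j, Tendsto (fun t => b t j) 𝓕 (𝓝 (y j))) (i : ℕ → Fin N) {n : ℕ}
    (hS : ∀ k < n, sgdIterate p F F' y μ x₀ i k ∈ S)
    (hSb : ∀ k < n, ∀ᶠ t in 𝓕, sgdIterate p F F' (b t) μ x₀ i k ∈ S) :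
    Tendsto (fun t => sgdIterate p F F' (b t) μ x₀ i n) 𝓕
      (𝓝 (sgdIterate p F F' y μ x₀ i n)) := by
  induction n with
  | zero => exact tendsto_const_nhds
  | succ n ih =>
    have hlim := ih (fun k hk => hS k (by omega)) fun k hk => hSb k (by omega)
    have hlimS := tendsto_nhdsWithin_iff.2 ⟨hlim, hSb n n.lt_succ_self⟩
    have hxS := hS n n.lt_succ_self
    have hF := (H.continuousOn (i (n + 1)) _ hxS).tendsto.comp hlimS
    have hF' := (H.continuousOn_deriv (i (n + 1)) _ hxS).tendsto.comp hlimS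
    have hdual := (((H.smooth_codomain (i (n + 1))).continuous_dualitySel
      H.conj.lt).tendsto _).comp (hF.sub (hb (i (n + 1))))
    have hgrad : Tendsto
        (fun t => sgdGradient p F F' (b t) (sgdIterate p F F' (b t) μ x₀ i n) (i (n + 1))) 𝓕
        (𝓝 (sgdGradient p F F' y (sgdIterate p F F' y μ x₀ i n) (i (n + 1)))) :=
      (isBoundedBilinearMap_comp.continuous.tendsto _).comp (hdual.prodMk_nhds hF')
    simp only [H.sgdIterate_succ]
    exact ((H.smooth_dual.continuous_dualitySelDual H.surjective_inclusionInDoubleDual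
      H.conj.symm.lt).tendsto _).comp
        ((((H.smooth.continuous_dualitySel H.conj.lt).tendsto _).comp hlim).sub
          (hgrad.const_smul _))

end SGDSetting

end Setting

section RandomIndices

variable {Ω α β ι : Type*} [MeasurableSpace Ω] {P : Measure Ω}

theorem integrable_of_dependsOn [Finite α] [MeasurableSpace α] [MeasurableSingletonClass α]
    [IsFiniteMeasure P] {i : ι → Ω → α} {T : Set ι} [Finite T] (hi : ∀ n ∈ T, Measurable (i n))
    {g : (ι → α) → ℝ} (hg : DependsOn g T) : Integrable (fun s => g fun n => i n s) P := by
  obtain ⟨f, rfl⟩ := dependsOn_iff_exists_comp.1 hg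
  exact Integrable.of_finite.comp_measurable
    (f := fun s (n : T) => i n s) (measurable_pi_lambda _ fun n => hi n n.2)

theorem integral_comp_eq_sum_of_indepFun [IsProbabilityMeasure P] [Finite α] [MeasurableSpace α]
    [MeasurableSingletonClass α] [Fintype β] [MeasurableSpace β] [MeasurableSingletonClass β]
    {U : Ω → α} {V : Ω → β} (hU : Measurable U) (hV : Measurable V) (hUV : IndepFun U V P)
    (g : α → β → ℝ) :
    ∫ s, g (U s) (V s) ∂P = ∑ b, P.real (V ⁻¹' {b}) * ∫ s, g (U s) b ∂P := by
  have := Measure.isProbabilityMeasure_map (μ := P) hU.aemeasurable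
  have := Measure.isProbabilityMeasure_map (μ := P) hV.aemeasurable
  calc ∫ s, g (U s) (V s) ∂P = ∫ z, g z.1 z.2 ∂P.map fun s => (U s, V s) :=
        (integral_map (f := fun z : α × β => g z.1 z.2) (hU.prodMk hV).aemeasurable
          (measurable_of_finite _).aestronglyMeasurable).symm
    _ = ∫ b, ∫ a, g a b ∂P.map U ∂P.map V := by
        rw [hUV.map_prod_eq_prod_map_map hU.aemeasurable hV.aemeasurable]
        exact integral_prod_symm _ .of_finite
    _ = ∑ b, P.real (V ⁻¹' {b}) * ∫ s, g (U s) b ∂P := by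
        rw [integral_fintype .of_finite]
        refine Finset.sum_congr rfl fun b _ => ?_
        rw [map_measureReal_apply hV (measurableSet_singleton b), smul_eq_mul,
          integral_map hU.aemeasurable (measurable_of_finite _).aestronglyMeasurable]

/-- The random indices `i 1, i 2, ...` are independent and uniformly distributed on `Fin N`; the
index `i 0` is never used. -/
structure IsUniformSampling {N : ℕ} (P : Measure Ω) (i : ℕ → Ω → Fin N) : Prop where
  measurable : ∀ n, 1 ≤ n → Measurable (i n)
  uniform : ∀ n, 1 ≤ n → ∀ j, P {s | i n s = j} = (N : ENNReal)⁻¹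
  iIndepFun : iIndepFun (fun n => i (n + 1)) P

namespace IsUniformSampling

variable {N : ℕ} {i : ℕ → Ω → Fin N}

theorem indepFun_next (hi : IsUniformSampling P i) (n : ℕ) :
    IndepFun (fun s (m : Set.Icc 1 n) => i m s) (i (n + 1)) P := by
  have hfinset := hi.iIndepFun.indepFun_finset (Finset.range n) {n} (by simp)
    fun m => hi.measurable _ m.succ_pos
  have hpast : ∀ m : Set.Icc 1 n, (m : ℕ) - 1 ∈ Finset.range n := fun m => by
    have := m.2.1
    have := m.2.2
    exact Finset.mem_range.2 (by omega)
  convert hfinset.comp (φ := fun t (m : Set.Icc 1 n) => t ⟨m - 1, hpast m⟩)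
    (ψ := fun t => t ⟨n, Finset.mem_singleton_self n⟩) (measurable_of_finite _)
    (measurable_of_finite _) using 1
  · ext s m
    simp only [Function.comp_apply, Nat.sub_add_cancel m.2.1]
  · rfl

theorem integral_apply_next [IsProbabilityMeasure P] (hi : IsUniformSampling P i)
    {g : (ℕ → Fin N) → Fin N → ℝ} {n : ℕ}
    (hg : ∀ j, DependsOn (fun t => g t j) (Set.Icc 1 n)) :
    ∫ s, g (fun m => i m s) (i (n + 1) s) ∂P =
      (N : ℝ)⁻¹ * ∑ j, ∫ s, g (fun m => i m s) j ∂P := by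
  choose f hf using fun j => dependsOn_iff_exists_comp.1 (hg j)
  have hfg (j : Fin N) (t : ℕ → Fin N) : g t j = f j ((Set.Icc 1 n).domRestrict t) :=
    congrFun (hf j) t
  simp only [hfg]
  have hpast : Measurable fun s (m : Set.Icc 1 n) => i m s :=
    measurable_pi_lambda _ fun m => hi.measurable m m.2.1
  refine (integral_comp_eq_sum_of_indepFun hpast (hi.measurable _ n.succ_pos)
    (hi.indepFun_next n) fun t j => f j t).trans ?_
  rw [Finset.mul_sum]
  refine Finset.sum_congr rfl fun j _ => ?_
  have hreal : P.real (i (n + 1) ⁻¹' {j}) = (N : ℝ)⁻¹ := by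
    rw [measureReal_def, show i (n + 1) ⁻¹' {j} = {s | i (n + 1) s = j} from rfl,
      hi.uniform _ n.succ_pos, ENNReal.toReal_inv, ENNReal.toReal_natCast]
  rw [hreal]
  rfl

end IsUniformSampling

end RandomIndices

section RealSequences

variable {a d e : ℕ → ℝ} {ε κ A : ℝ}

theorem frequently_lt_of_summable_mul (ha : ∀ n, 0 ≤ a n) (hdiv : ¬Summable a)
    (hsum : Summable fun n => a n * e n) (hε : 0 < ε) : ∃ᶠ k in atTop, e k < ε := by
  by_contra hlarge
  simp only [not_frequently, not_lt] at hlarge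
  refine hdiv ((hsum.mul_left ε⁻¹).of_norm_bounded_eventually_nat ?_)
  filter_upwards [hlarge] with n hn
  rw [Real.norm_of_nonneg (ha n), mul_left_comm]
  exact le_mul_of_one_le_right (ha n) ((one_le_inv_mul₀ hε).2 hn)

theorem exists_lt_and_forall_le {l : ℕ} (h : ∃ k, l ≤ k ∧ e k < ε) :
    ∃ k, l ≤ k ∧ e k < ε ∧ ∀ m, l ≤ m → m < k → e k ≤ e m := by
  classical
  obtain ⟨hlk, hk⟩ := Nat.find_spec h
  refine ⟨Nat.find h, hlk, hk, fun m hlm hmk => hk.le.trans ?_⟩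
  exact not_lt.1 fun hm => Nat.find_min h hmk ⟨hlm, hm⟩

theorem summable_mul_of_mul_le_sub (hκ : 0 < κ) (hd : ∀ n, 0 ≤ d n) (he : ∀ n, 0 ≤ e n)
    (ha : ∀ n, 0 ≤ a n) (hstep : ∀ n, κ * (a n * e n) ≤ d n - d (n + 1)) :
    Summable fun n => a n * e n := by
  rw [← summable_mul_left_iff hκ.ne']
  refine summable_of_sum_range_le (c := d 0)
    (fun n => mul_nonneg hκ.le (mul_nonneg (ha n) (he n))) fun n => ?_
  calc ∑ m ∈ Finset.range n, κ * (a m * e m) ≤ ∑ m ∈ Finset.range n, (d m - d (m + 1)) :=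
        Finset.sum_le_sum fun m _ => hstep m
    _ = d 0 - d n := Finset.sum_range_sub' d n
    _ ≤ d 0 := sub_le_self _ (hd n)

theorem tendsto_zero_of_le_at_running_minima (hκ : 0 < κ) (hA : 0 ≤ A) (hd : ∀ n, 0 ≤ d n)
    (he : ∀ n, 0 ≤ e n) (ha : ∀ n, 0 ≤ a n) (hdiv : ¬Summable a)
    (hstep : ∀ n, κ * (a n * e n) ≤ d n - d (n + 1))
    (hmin : ∀ l, ∀ ε > 0, ∃ Q : ℝ, ∀ k, l ≤ k → (∀ m, l ≤ m → m < k → e k ≤ e m) →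
      d k ≤ ε + Q * e k + A * (d l - d k)) :
    Tendsto d atTop (𝓝 0) := by
  have hanti : Antitone d := antitone_nat_of_succ_le fun n =>
    sub_nonneg.1 ((mul_nonneg hκ.le (mul_nonneg (ha n) (he n))).trans (hstep n))
  have hbdd : BddBelow (Set.range d) := ⟨0, Set.forall_mem_range.2 hd⟩
  have hlim := tendsto_atTop_ciInf hanti hbdd
  set D := ⨅ n, d n
  have hsum := summable_mul_of_mul_le_sub hκ hd he ha hstep
  have hDle (l : ℕ) : D ≤ A * (d l - D) := by
    refine le_of_forall_pos_le_add fun ε hε => ?_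
    obtain ⟨Q, hQ⟩ := hmin l (ε / 2) (half_pos hε)
    have hη : 0 < ε / 2 / (|Q| + 1) := by positivity
    obtain ⟨k, hlk, hsmall, hk⟩ := exists_lt_and_forall_le <|
      frequently_atTop.1 (frequently_lt_of_summable_mul ha hdiv hsum hη) l
    have hQe : Q * e k ≤ ε / 2 :=
      calc Q * e k ≤ (|Q| + 1) * (ε / 2 / (|Q| + 1)) :=
            mul_le_mul (by linarith [le_abs_self Q]) hsmall.le (he k) (by positivity)
        _ = ε / 2 := mul_div_cancel₀ _ (by positivity)
    have hDk : D ≤ d k := ciInf_le hbdd k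
    calc D ≤ d k := hDk
      _ ≤ ε / 2 + Q * e k + A * (d l - d k) := hQ k hlk hk
      _ ≤ ε / 2 + ε / 2 + A * (d l - D) := by gcongr
      _ = A * (d l - D) + ε := by ring
  have hD : D = 0 := by
    refine le_antisymm (ge_of_tendsto' (f := fun l => A * (d l - D)) (x := atTop) ?_ hDle)
      (le_ciInf hd)
    simpa using (hlim.sub_const D).const_mul A
  rwa [hD] at hlim

end RealSequences

section Expectation

variable {X : Type*} [NormedAddCommGroup X] [NormedSpace ℝ X]
  {N : ℕ} {Y : Fin N → Type*} [∀ i, NormedAddCommGroup (Y i)] [∀ i, NormedSpace ℝ (Y i)]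
  {p p' c γ Λ ν C : ℝ} {F : ∀ i, X → Y i} {F' : ∀ i, X → X →L[ℝ] Y i}
  {y : ∀ i, Y i} {S : Set X} {x₀ xs : X} {μ : ℕ → ℝ}
  {Ω : Type*} [MeasurableSpace Ω] {P : Measure Ω} {i : ℕ → Ω → Fin N}

theorem integrable_comp_sgdIterate [IsFiniteMeasure P] (hi : ∀ n, 1 ≤ n → Measurable (i n))
    (F : ∀ i, X → Y i) (F' : ∀ i, X → X →L[ℝ] Y i) (b : ∀ i, Y i) (μ : ℕ → ℝ) (x₀ : X)
    (f : X → ℝ) (n : ℕ) :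
    Integrable (fun s => f (sgdIterate p F F' b μ x₀ (fun m => i m s) n)) P :=
  integrable_of_dependsOn (fun m hm => hi m hm.1)
    fun _ _ h => congrArg f (dependsOn_sgdIterate F F' b μ x₀ n h)

theorem integrable_comp_sgdIterate_next [IsFiniteMeasure P] (hi : ∀ n, 1 ≤ n → Measurable (i n))
    (F : ∀ i, X → Y i) (F' : ∀ i, X → X →L[ℝ] Y i) (b : ∀ i, Y i) (μ : ℕ → ℝ) (x₀ : X)
    (f : X → Fin N → ℝ) (n : ℕ) :
    Integrable
      (fun s => f (sgdIterate p F F' b μ x₀ (fun m => i m s) n) (i (n + 1) s)) P :=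
  integrable_of_dependsOn (T := Set.Icc 1 (n + 1)) (fun m hm => hi m hm.1)
    (g := fun t => f (sgdIterate p F F' b μ x₀ t n) (t (n + 1))) fun _ _ h =>
      congrArg₂ f (dependsOn_sgdIterate F F' b μ x₀ n fun m hm => h m ⟨hm.1, hm.2.trans n.le_succ⟩)
        (h (n + 1) ⟨n.succ_pos, le_rfl⟩)

theorem integral_norm_rpow_sampled [IsProbabilityMeasure P] (hi : IsUniformSampling P i)
    (F : ∀ i, X → Y i) (F' : ∀ i, X → X →L[ℝ] Y i) (y : ∀ i, Y i) (μ : ℕ → ℝ) (x₀ : X) (n : ℕ) :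
    ∫ s, ‖F (i (n + 1) s) (sgdIterate p F F' y μ x₀ (fun m => i m s) n) -
        y (i (n + 1) s)‖ ^ p ∂P =
      (N : ℝ)⁻¹ * ∫ s, residual p F y (sgdIterate p F F' y μ x₀ (fun m => i m s) n) ∂P := by
  rw [hi.integral_apply_next (g := fun t j => ‖F j (sgdIterate p F F' y μ x₀ t n) - y j‖ ^ p)
    fun j t t' h => congrArg (fun x => ‖F j x - y j‖ ^ p) (dependsOn_sgdIterate F F' y μ x₀ n h)]
  simp only [residual]
  rw [integral_finsetSum _ fun j _ => integrable_comp_sgdIterate hi.measurable F F' y μ x₀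
    (fun x => ‖F j x - y j‖ ^ p) n]

namespace SGDSetting

variable [CompleteSpace X] [IsProbabilityMeasure P]

theorem mul_integral_residual_le (H : SGDSetting p p' c γ Λ ν F F' y S x₀ xs)
    (hμ : IsAdmissibleStepSize p' c γ Λ C μ) (hi : IsUniformSampling P i) (n : ℕ) :
    C / 2 * (N : ℝ)⁻¹ * (μ (n + 1) *
        ∫ s, residual p F y (sgdIterate p F F' y μ x₀ (fun m => i m s) n) ∂P) ≤
      ∫ s, bregman p (sgdIterate p F F' y μ x₀ (fun m => i m s) n) xs ∂P -
        ∫ s, bregman p (sgdIterate p F F' y μ x₀ (fun m => i m s) (n + 1)) xs ∂P := by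
  have hintD := integrable_comp_sgdIterate (P := P) (p := p) hi.measurable F F' y μ x₀
    fun x => bregman p x xs
  have hintr := integrable_comp_sgdIterate_next (P := P) (p := p) hi.measurable F F' y μ x₀
    (fun x j => ‖F j x - y j‖ ^ p) n
  rw [← integral_sub (hintD n) (hintD (n + 1))]
  refine Eq.trans_le ?_ (integral_mono ((hintr.const_mul _).const_mul _)
    ((hintD n).sub (hintD (n + 1))) fun s =>
      H.mul_norm_rpow_le_bregman_sub_exact hμ (fun m => i m s) n)
  rw [integral_const_mul, integral_const_mul, integral_norm_rpow_sampled hi]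
  ring

theorem exists_integral_bregman_exact_le (H : SGDSetting p p' c γ Λ ν F F' y S x₀ xs)
    (hμ : IsAdmissibleStepSize p' c γ Λ C μ) (hi : IsUniformSampling P i) (l : ℕ) {ε : ℝ}
    (hε : 0 < ε) :
    ∃ Q : ℝ, ∀ k, l ≤ k →
      ∫ s, bregman p (sgdIterate p F F' y μ x₀ (fun m => i m s) k) xs ∂P ≤
        ε + Q * ∫ s, residual p F y (sgdIterate p F F' y μ x₀ (fun m => i m s) k) ∂P +
        ∑ m ∈ Finset.Ico l k, μ (m + 1) * ((1 + γ) *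
          (3 * ((N : ℝ)⁻¹ *
              ∫ s, residual p F y (sgdIterate p F F' y μ x₀ (fun m => i m s) m) ∂P) +
            ∫ s, residual p F y (sgdIterate p F F' y μ x₀ (fun m => i m s) k) ∂P)) := by
  obtain ⟨Q, hQ⟩ := H.exists_bregman_sgdIterate_exact_le hμ l hε
  refine ⟨Q, fun k hlk => ?_⟩
  have hintR := integrable_comp_sgdIterate (P := P) (p := p) hi.measurable F F' y μ x₀
    (residual p F y) k
  have hintr := integrable_comp_sgdIterate_next (P := P) (p := p) hi.measurable F F' y μ x₀
    fun x j => ‖F j x - y j‖ ^ p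
  have hstart := (integrable_const ε).add (hintR.const_mul Q)
  have hterm (m : ℕ) := ((((hintr m).const_mul 3).add hintR).const_mul (1 + γ)).const_mul
    (μ (m + 1))
  have hrest := integrable_finsetSum (Finset.Ico l k) fun m _ => hterm m
  refine (integral_mono (integrable_comp_sgdIterate hi.measurable F F' y μ x₀
    (fun x => bregman p x xs) k) (hstart.add hrest) fun s => hQ (fun m => i m s) k hlk).trans_eq ?_
  rw [integral_add' hstart hrest, integral_add' (integrable_const ε) (hintR.const_mul Q),
    integral_const, probReal_univ, one_smul, integral_const_mul,
    integral_finsetSum _ fun m _ => hterm m]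
  refine congrArg _ (Finset.sum_congr rfl fun m _ => ?_)
  rw [integral_const_mul, integral_const_mul, integral_add' ((hintr m).const_mul 3) hintR,
    integral_const_mul, integral_norm_rpow_sampled hi]

-- At a running minimum of the residual, the residual of `x_k` may be replaced by that of `x_m`, so
-- that the sum telescopes by `mul_integral_residual_le`.
theorem exists_integral_bregman_exact_le_of_running_minimum
    (H : SGDSetting p p' c γ Λ ν F F' y S x₀ xs) (hN : N ≠ 0)
    (hμ : IsAdmissibleStepSize p' c γ Λ C μ) (hi : IsUniformSampling P i) (l : ℕ) {ε : ℝ}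
    (hε : 0 < ε) :
    ∃ Q : ℝ, ∀ k, l ≤ k →
      (∀ m, l ≤ m → m < k →
        ∫ s, residual p F y (sgdIterate p F F' y μ x₀ (fun m => i m s) k) ∂P ≤
          ∫ s, residual p F y (sgdIterate p F F' y μ x₀ (fun m => i m s) m) ∂P) →
      ∫ s, bregman p (sgdIterate p F F' y μ x₀ (fun m => i m s) k) xs ∂P ≤
        ε + Q * ∫ s, residual p F y (sgdIterate p F F' y μ x₀ (fun m => i m s) k) ∂P +
        (1 + γ) * (3 * (N : ℝ)⁻¹ + 1) / (C / 2 * (N : ℝ)⁻¹) *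
          (∫ s, bregman p (sgdIterate p F F' y μ x₀ (fun m => i m s) l) xs ∂P -
            ∫ s, bregman p (sgdIterate p F F' y μ x₀ (fun m => i m s) k) xs ∂P) := by
  obtain ⟨Q, hQ⟩ := H.exists_integral_bregman_exact_le hμ hi l hε
  refine ⟨Q, fun k hlk hmin => (hQ k hlk).trans (add_le_add_right ?_ _)⟩
  have hstep := H.mul_integral_residual_le hμ hi
  set d : ℕ → ℝ := fun n => ∫ s, bregman p (sgdIterate p F F' y μ x₀ (fun m => i m s) n) xs ∂P
  set e : ℕ → ℝ := fun n => ∫ s, residual p F y (sgdIterate p F F' y μ x₀ (fun m => i m s) n) ∂P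
  have hC := hμ.C_pos
  have hγ := H.γ_nonneg
  have htelescope : ∑ m ∈ Finset.Ico l k, (d m - d (m + 1)) = d l - d k := by
    rw [← neg_sub (d k), ← Finset.sum_Ico_sub d hlk, ← Finset.sum_neg_distrib]
    simp only [neg_sub]
  rw [← htelescope, Finset.mul_sum]
  refine Finset.sum_le_sum fun m hm => ?_
  obtain ⟨hlm, hmk⟩ := Finset.mem_Ico.1 hm
  have hμm := (hμ.pos (m + 1) m.succ_pos).le
  calc μ (m + 1) * ((1 + γ) * (3 * ((N : ℝ)⁻¹ * e m) + e k))
      ≤ μ (m + 1) * ((1 + γ) * (3 * ((N : ℝ)⁻¹ * e m) + e m)) := by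
        gcongr
        exact hmin m hlm hmk
    _ = (1 + γ) * (3 * (N : ℝ)⁻¹ + 1) / (C / 2 * (N : ℝ)⁻¹) *
        (C / 2 * (N : ℝ)⁻¹ * (μ (m + 1) * e m)) := by field_simp
    _ ≤ (1 + γ) * (3 * (N : ℝ)⁻¹ + 1) / (C / 2 * (N : ℝ)⁻¹) * (d m - d (m + 1)) := by
        gcongr
        exact hstep m

theorem tendsto_integral_bregman_exact (H : SGDSetting p p' c γ Λ ν F F' y S x₀ xs)
    (hμ : IsAdmissibleStepSize p' c γ Λ C μ) (hdiv : ¬Summable fun n => μ (n + 1))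
    (hi : IsUniformSampling P i) :
    Tendsto (fun n => ∫ s, bregman p (sgdIterate p F F' y μ x₀ (fun m => i m s) n) xs ∂P)
      atTop (𝓝 0) := by
  obtain ⟨s₀⟩ := nonempty_of_isProbabilityMeasure P
  have hN : 0 < N := (i 0 s₀).pos
  have hC := hμ.C_pos
  have hγ := H.γ_nonneg
  exact tendsto_zero_of_le_at_running_minima (κ := C / 2 * (N : ℝ)⁻¹) (by positivity)
    (by positivity : 0 ≤ (1 + γ) * (3 * (N : ℝ)⁻¹ + 1) / (C / 2 * (N : ℝ)⁻¹))
    (fun n => integral_nonneg fun s => bregman_nonneg H.conj _ _)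
    (fun n => integral_nonneg fun s => residual_nonneg F y _)
    (fun n => (hμ.pos _ n.succ_pos).le) hdiv (H.mul_integral_residual_le hμ hi)
    fun l ε hε => H.exists_integral_bregman_exact_le_of_running_minimum hN.ne' hμ hi l hε

theorem integral_bregman_le_add_sum_range (H : SGDSetting p p' c γ Λ ν F F' y S x₀ xs)
    (hμ : IsAdmissibleStepSize p' c γ Λ C μ) (hi : ∀ n, 1 ≤ n → Measurable (i n))
    {b : ∀ i, Y i} {δ : ℝ} (hb : ∀ j, ‖y j - b j‖ ≤ δ) {l n : ℕ} (hln : l ≤ n)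
    (hn : bregman p x₀ xs +
      noiseConst p γ C * (δ ^ p * ∑ m ∈ Finset.range n, μ (m + 1)) ≤ ν) :
    ∫ s, bregman p (sgdIterate p F F' b μ x₀ (fun m => i m s) n) xs ∂P ≤
      ∫ s, bregman p (sgdIterate p F F' b μ x₀ (fun m => i m s) l) xs ∂P +
        noiseConst p γ C * (δ ^ p * ∑ m ∈ Finset.range n, μ (m + 1)) := by
  have hint := integrable_comp_sgdIterate (P := P) (p := p) hi F F' b μ x₀
    fun x => bregman p x xs
  refine (integral_mono (hint n) ((hint l).add (integrable_const _)) fun s =>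
    H.bregman_sgdIterate_le_add_sum_range hμ hb hln le_rfl fun m hm =>
      H.ball_subset (H.bregman_sgdIterate_le hμ hb _ hn hm.le)).trans_eq ?_
  rw [integral_add' (hint l) (integrable_const _), integral_const, probReal_univ, one_smul]

theorem tendsto_integral_bregman_sgdIterate (H : SGDSetting p p' c γ Λ ν F F' y S x₀ xs)
    (hμ : IsAdmissibleStepSize p' c γ Λ C μ) (hi : ∀ n, 1 ≤ n → Measurable (i n)) {ι : Type*}
    {𝓕 : Filter ι} [𝓕.IsCountablyGenerated] {b : ι → ∀ i, Y i}
    (hb : ∀ j, Tendsto (fun t => b t j) 𝓕 (𝓝 (y j))) {n : ℕ}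
    (hν : ∀ᶠ t in 𝓕, ∀ (j : ℕ → Fin N), ∀ k ≤ n,
      bregman p (sgdIterate p F F' (b t) μ x₀ j k) xs ≤ ν) :
    Tendsto (fun t => ∫ s, bregman p (sgdIterate p F F' (b t) μ x₀ (fun m => i m s) n) xs ∂P) 𝓕
      (𝓝 (∫ s, bregman p (sgdIterate p F F' y μ x₀ (fun m => i m s) n) xs ∂P)) := by
  refine tendsto_integral_filter_of_dominated_convergence (fun _ => ν) (.of_forall fun t =>
    (integrable_comp_sgdIterate hi F F' (b t) μ x₀
      (fun x => bregman p x xs) n).aestronglyMeasurable)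
    (hν.mono fun t ht => .of_forall fun s => ?_) (integrable_const ν) (.of_forall fun s => ?_)
  · rw [Real.norm_of_nonneg (bregman_nonneg H.conj _ _)]
    exact ht _ n le_rfl
  · exact ((H.smooth.continuous_bregman_left H.conj xs).tendsto _).comp
      (H.tendsto_sgdIterate hb _ (fun k _ => H.sgdIterate_exact_mem hμ _ k)
        fun k hk => hν.mono fun t ht => H.ball_subset (ht _ k hk.le))

theorem tendsto_integral_bregman_noisy (H : SGDSetting p p' c γ Λ ν F F' y S x₀ xs)
    (hμ : IsAdmissibleStepSize p' c γ Λ C μ) (hdiv : ¬Summable fun n => μ (n + 1))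
    (hi : IsUniformSampling P i) {ι : Type*} {𝓕 : Filter ι} [𝓕.IsCountablyGenerated]
    {δ : ι → ℝ} (hδ : Tendsto δ 𝓕 (𝓝 0)) {b : ι → ∀ i, Y i}
    (hb : ∀ᶠ t in 𝓕, ∀ j, ‖y j - b t j‖ ≤ δ t) {k : ι → ℕ} (hk : Tendsto k 𝓕 atTop)
    (hkμ : Tendsto (fun t => δ t ^ p * ∑ m ∈ Finset.range (k t), μ (m + 1)) 𝓕 (𝓝 0)) :
    Tendsto (fun t => ∫ s, bregman p (sgdIterate p F F' (b t) μ x₀ (fun m => i m s) (k t)) xs ∂P)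
      𝓕 (𝓝 0) := by
  have hnoise : Tendsto (fun t => noiseConst p γ C *
      (δ t ^ p * ∑ m ∈ Finset.range (k t), μ (m + 1))) 𝓕 (𝓝 0) := by
    simpa using hkμ.const_mul (noiseConst p γ C)
  have hν : ∀ᶠ t in 𝓕, bregman p x₀ xs +
      noiseConst p γ C * (δ t ^ p * ∑ m ∈ Finset.range (k t), μ (m + 1)) ≤ ν := by
    filter_upwards [hnoise.eventually (gt_mem_nhds (sub_pos.2 H.bregman_lt))] with t ht
    linarith
  have hdata (j : Fin N) : Tendsto (fun t => b t j) 𝓕 (𝓝 (y j)) := by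
    refine tendsto_iff_norm_sub_tendsto_zero.2
      (squeeze_zero' (.of_forall fun _ => norm_nonneg _) (hb.mono fun t ht => ?_) hδ)
    exact (norm_sub_rev _ _).trans_le (ht j)
  refine tendsto_order.2 ⟨fun a ha => .of_forall fun t => ha.trans_le
    (integral_nonneg fun s => bregman_nonneg H.conj _ _), fun ε hε => ?_⟩
  obtain ⟨n, hn⟩ := ((H.tendsto_integral_bregman_exact hμ hdiv hi).eventually
    (gt_mem_nhds (half_pos hε))).exists
  have hfixed := H.tendsto_integral_bregman_sgdIterate (P := P) hμ hi.measurable hdata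
      (n := n) <| by
    filter_upwards [hb, hν, hk.eventually_ge_atTop n] with t hbt hνt hkt j m hm
    exact H.bregman_sgdIterate_le hμ hbt j hνt (hm.trans hkt)
  filter_upwards [hb, hν, hk.eventually_ge_atTop n, hfixed.eventually (gt_mem_nhds hn),
    hnoise.eventually (gt_mem_nhds (half_pos hε))] with t hbt hνt hkt hnt hnoiset
  linarith [H.integral_bregman_le_add_sum_range (P := P) hμ hi.measurable hbt hkt hνt]

end SGDSetting

end Expectation

theorem sum_Icc_one_eq_sum_range {M : Type*} [AddCommMonoid M] (f : ℕ → M) (n : ℕ) :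
    ∑ l ∈ Finset.Icc 1 n, f l = ∑ m ∈ Finset.range n, f (m + 1) := by
  rw [Finset.range_eq_Ico, Finset.sum_Ico_add', zero_add]
  rfl

theorem pos_of_eventually_rpow_mul_sum_le {p Γ : ℝ} {μ : ℕ → ℝ} {k : ℝ → ℕ}
    (hμ : ∀ l, 1 ≤ l → 0 < μ l) (hk : Tendsto k (𝓝[>] 0) atTop)
    (hkΓ : ∀ᶠ δ in 𝓝[>] (0 : ℝ), δ ^ p * ∑ l ∈ Finset.Icc 1 (k δ), μ l ≤ Γ) : 0 < Γ := by
  have hδ : ∀ᶠ δ : ℝ in 𝓝[>] 0, 0 < δ := self_mem_nhdsWithin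
  obtain ⟨δ, hle, hpos, hk1⟩ := (hkΓ.and (hδ.and (hk.eventually_ge_atTop 1))).exists
  have hsum : 0 < ∑ l ∈ Finset.Icc 1 (k δ), μ l :=
    Finset.sum_pos (fun l hl => hμ l (Finset.mem_Icc.1 hl).1) (Finset.nonempty_Icc.2 hk1)
  exact (by positivity : 0 < δ ^ p * ∑ l ∈ Finset.Icc 1 (k δ), μ l).trans_le hle

end SGDBanach

open SGDBanach in
theorem mainTheorem3_general
    {X : Type*} [NormedAddCommGroup X] [NormedSpace ℝ X] [CompleteSpace X]
    {N : ℕ} {Y : Fin N → Type*} [∀ i, NormedAddCommGroup (Y i)] [∀ i, NormedSpace ℝ (Y i)]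
    {p p' : ℝ} (hpp' : p.HolderConjugate p')
    (hX : IsUniformlySmooth X) (hY : ∀ i, IsUniformlySmooth (Y i))
    {c : ℝ} (hc : 0 ≤ c) (hXdual : IsPowerSmooth p' c (StrongDual ℝ X))
    {F : ∀ i, X → Y i} {F' : ∀ i, X → X →L[ℝ] Y i} {y : ∀ i, Y i} {S : Set X} {x₀ xs : X}
    (hxs : IsMinDistSolution p S F y x₀ xs)
    {γ ν : ℝ} (hγ : 0 ≤ γ) (hγ' : γ < 1) (hν : bregman p x₀ xs < ν)
    (hball : bregmanBall p ν xs ⊆ S)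
    (hF' : ∀ i, ∀ x ∈ S, HasFDerivWithinAt (F i) (F' i x) S x)
    (hF'cont : ∀ i, ContinuousOn (F' i) S)
    {Λ : ℝ} (hΛ : ∀ i, ∀ x ∈ S, ‖F' i x‖ ≤ Λ)
    (hcone : ∀ i, TangentialCone γ (F i) (F' i) S)
    (hnull : ∀ x ∈ S, ∀ h : X, (∀ i, F' i xs h = 0) → ∀ i, F' i x h = 0)
    {μ : ℕ → ℝ} {C : ℝ} (hμ : IsAdmissibleStepSize p' c γ Λ C μ)
    (hμsum : Tendsto (fun n : ℕ => ∑ l ∈ Finset.Icc 1 n, μ l) atTop atTop)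
    {yδ : ℝ → ∀ i, Y i} (hyδ : ∀ δ, 0 < δ → ∀ i, ‖y i - yδ δ i‖ ≤ δ)
    {k : ℝ → ℕ} (hk : Tendsto k (𝓝[>] 0) atTop)
    (hkμ : Tendsto (fun δ : ℝ => δ ^ p * ∑ l ∈ Finset.Icc 1 (k δ), μ l) (𝓝[>] 0) (𝓝 0))
    {Ω : Type*} [MeasurableSpace Ω] {P : Measure Ω} [IsProbabilityMeasure P]
    {i : ℕ → Ω → Fin N} (hi : IsUniformSampling P i) :
    (∀ δ, 0 < δ → Integrable (fun s =>
      bregman p (sgdIterate p F F' (yδ δ) μ x₀ (fun n => i n s) (k δ)) xs) P) ∧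
    Tendsto (fun δ : ℝ => ∫ s,
      bregman p (sgdIterate p F F' (yδ δ) μ x₀ (fun n => i n s) (k δ)) xs ∂P)
      (𝓝[>] 0) (𝓝 0) := by
  have H : SGDSetting p p' c γ Λ ν F F' y S x₀ xs :=
    { conj := hpp', smooth := hX, smooth_codomain := hY, c_nonneg := hc, powerSmooth_dual := hXdual,
      isSolution := hxs, γ_nonneg := hγ, γ_lt_one := hγ', bregman_lt := hν, ball_subset := hball,
      continuousOn := fun i x hx => (hF' i x hx).continuousWithinAt,
      continuousOn_deriv := hF'cont, norm_deriv_le := hΛ, cone := hcone, null := hnull }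
  simp only [sum_Icc_one_eq_sum_range] at hμsum hkμ
  have hdiv : ¬Summable fun n => μ (n + 1) :=
    (not_summable_iff_tendsto_nat_atTop_of_nonneg fun n => (hμ.pos _ n.succ_pos).le).2 hμsum
  have hdata : ∀ᶠ δ in 𝓝[>] (0 : ℝ), ∀ j, ‖y j - yδ δ j‖ ≤ δ :=
    mem_of_superset self_mem_nhdsWithin hyδ
  exact ⟨fun δ _ => integrable_comp_sgdIterate hi.measurable F F' (yδ δ) μ x₀
      (fun x => bregman p x xs) (k δ),
    H.tendsto_integral_bregman_noisy hμ hdiv hi (tendsto_id.mono_left nhdsWithin_le_nhds)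
      hdata hk hkμ⟩

theorem mainTheorem3
    {X : Type*} [NormedAddCommGroup X] [NormedSpace ℝ X] [CompleteSpace X]
    {N : ℕ} {Y : Fin N → Type*} [∀ i, NormedAddCommGroup (Y i)] [∀ i, NormedSpace ℝ (Y i)]
    [∀ i, CompleteSpace (Y i)]
    -- exponents and geometry of the spaces
    (p p' : ℝ) (hpp' : p.HolderConjugate p')
    (hX : SGDBanach.IsPConvex p X) (hX' : SGDBanach.IsUniformlySmooth X)
    (hY : ∀ i, SGDBanach.IsUniformlySmooth (Y i))
    -- the constant of the upper Bregman bound in the dual space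
    (G : ℝ) (hG : 0 < G)
    (hGbound : ∀ ξ η : StrongDual ℝ X, SGDBanach.bregman p' ξ η ≤ G / p' * ‖η - ξ‖ ^ p')
    -- forward operators, exact data, the set `S`, and the reference solution
    (F : ∀ i, X → Y i) (F' : ∀ i, X → X →L[ℝ] Y i) (y : ∀ i, Y i)
    (S : Set X) (hSclosed : IsClosed S) (hSconvex : Convex ℝ S)
    (x₀ xs : X) (hxs : SGDBanach.IsMinDistSolution p S F y x₀ xs)
    -- the Bregman ball
    (γ ω Γ ν : ℝ) (hγ : 0 < γ) (hγ' : γ < 1 / 2) (hω : 0 < ω)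
    (hν : ν = SGDBanach.bregman p x₀ xs + ω ^ (-p) / p * (1 + γ) ^ p * Γ)
    (hball : SGDBanach.bregmanBall p ν xs ⊆ S)
    -- continuous differentiability, bounded derivatives, tangential cone condition
    (hF' : ∀ i, ∀ x ∈ S, HasFDerivWithinAt (F i) (F' i x) S x)
    (hF'cont : ∀ i, ContinuousOn (F' i) S)
    (L : Fin N → ℝ) (hL : ∀ i, ∀ x ∈ S, ‖F' i x‖ ≤ L i)
    (hTCC : ∀ i, ∀ x ∈ S, ∀ x' ∈ S,
      ‖F i x - F i x' - F' i x (x - x')‖ ≤ γ * ‖F i x - F i x'‖)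
    -- weak continuity and the null-space condition for `F' = (F'_1, ..., F'_N)`
    (hFweak : ∀ i, SGDBanach.WeakToWeakContinuousOn (F i) S)
    (hnull : ∀ x ∈ S, ∀ h : X, (∀ i, F' i xs h = 0) → ∀ i, F' i x h = 0)
    -- step sizes `μ 1, μ 2, ...`
    (μ : ℕ → ℝ) (hμ : ∀ l, 1 ≤ l → 0 < μ l)
    (hμsum : Tendsto (fun n : ℕ => ∑ l ∈ Finset.Icc 1 n, μ l) atTop atTop)
    (C : ℝ) (hC : 0 < C)
    (hμC : ∀ l, 1 ≤ l →
      C ≤ 1 - γ - (⨆ i, L i) ^ p' * (G / p') * μ l ^ (p' - 1) - (p - 1) / p ^ 2 * ω ^ p')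
    -- noisy data and stopping indices
    (yδ : ℝ → ∀ i, Y i) (hyδ : ∀ δ, 0 < δ → ∀ i, ‖y i - yδ δ i‖ ≤ δ)
    (k : ℝ → ℕ) (hk : Tendsto k (𝓝[>] 0) atTop)
    (hkΓ : ∀ᶠ δ in 𝓝[>] (0 : ℝ), δ ^ p * ∑ l ∈ Finset.Icc 1 (k δ), μ l ≤ Γ)
    (hkμ : Tendsto (fun δ : ℝ => δ ^ p * ∑ l ∈ Finset.Icc 1 (k δ), μ l) (𝓝[>] 0) (𝓝 0))
    -- independent, uniformly distributed indices `i 1, i 2, ...`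
    {Ω : Type*} [MeasurableSpace Ω] (P : Measure Ω) [IsProbabilityMeasure P]
    (i : ℕ → Ω → Fin N) (hi : ∀ n, 1 ≤ n → Measurable (i n))
    (hiunif : ∀ n, 1 ≤ n → ∀ j : Fin N, P {s | i n s = j} = (N : ENNReal)⁻¹)
    (hiindep : iIndepFun (fun n : ℕ => i (n + 1)) P) :
    (∀ δ, 0 < δ → Integrable (fun s =>
      SGDBanach.bregman p
        (SGDBanach.sgdIterate p F F' (yδ δ) μ x₀ (fun n => i n s) (k δ)) xs) P) ∧
    Tendsto (fun δ : ℝ => ∫ s,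
      SGDBanach.bregman p
        (SGDBanach.sgdIterate p F F' (yδ δ) μ x₀ (fun n => i n s) (k δ)) xs ∂P)
      (𝓝[>] 0) (𝓝 0) := by
  have hp := hpp'.pos
  have hp' := hpp'.symm.pos
  have hΓ : 0 < Γ := SGDBanach.pos_of_eventually_rpow_mul_sum_le hμ hk hkΓ
  have hνlt : SGDBanach.bregman p x₀ xs < ν := by
    rw [hν, lt_add_iff_pos_right]
    positivity
  have hΛ (j : Fin N) (x : X) (hx : x ∈ S) : ‖F' j x‖ ≤ ⨆ i, L i :=
    (hL j x hx).trans (le_ciSup (Set.finite_range L).bddAbove j)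
  have hω' : 0 ≤ (p - 1) / p ^ 2 * ω ^ p' := by
    have := hpp'.sub_one_pos
    positivity
  exact mainTheorem3_general hpp' hX' hY (by positivity) hGbound hxs hγ.le (by linarith) hνlt hball
    hF' hF'cont hΛ hTCC hnull ⟨hC, hμ, fun l hl => by linarith [hμC l hl]⟩ hμsum hyδ hk hkμ
    ⟨hi, hiunif, hiindep⟩
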